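/- Conventions. A $2$-category is strict, as are $2$-functors and $2$-natural transformations; $\mathcal D(A,B)$ is the category of $1$-cells $A\to B$ and $2$-cells between them. A $2$-functor $G:\mathcal D\to \mathrm{Cat}$ is representable if it is isomorphic to $\mathcal D(A,-)$, $2$-naturally, for some object $A$. The weight $W_r$. Let $\Delta$ be the category of finite ordinals $n=\{0,\dots ,n-1\}$, $n\ge 0$, and monotone maps; it is strict monoidal under ordinal sum $+$. Let $\mathbf\Delta$ be the corresponding $2$-category with one object $*$: its $1$-cells are the $n\in\Delta$, with composition $n\circ m=n+m$, and its $2$-cells are the morphisms of $\Delta$. Let $\Pi_r$ be the category with the same objects, whose morphisms $n\to m$ are the partial maps $f$ from $n$ to $m$ that are monotone where defined and such that if $f(i)$ is defined and $i\le j$, then $f(j)$ is defined. The weight $W_r:\mathbf\Delta^{op}\to \mathrm{Cat}$ (where $\mathbf\Delta^{op}$ has reversed $1$-cells) is the $2$-functor given by the right action of $\Delta$ on $\Pi_r$: $$W_r(*)=\Pi_r,\qquad W_r(n)=(-)+n,\qquad W_r(f)=(-)+f .$$ For a $2$-functor $\mathbf T:\mathbf\Delta\to\mathcal D$, a $W_r$-weighted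 colimit of $\mathbf T$ is a representing object of the $2$-functor $\mathcal D\to \mathrm{Cat}$ that sends $X$ to the category of $2$-natural transformations $W_r\to \mathcal D(\mathbf T(-),X)$ and modifications between them. Kleisli objects. A monad in $\mathcal D$ is a tuple $(C,T,\eta,\mu)$ with $T:C\to C$, $\eta:1_C\Rightarrow T$, $\mu:TT\Rightarrow T$ satisfying the unit and associativity laws. A colax morphism $(C,T,\eta,\mu)\to(C',T',\eta',\mu')$ is a $1$-cell $F:C\to C'$ with a $2$-cell $\tau:FT\Rightarrow T'F$ such that $\tau\cdot F\eta=\eta'F$ and $\tau\cdot F\mu=\mu'F\cdot T'\tau\cdot\tau T$. A transformation $(F,\tau)\Rightarrow(G,\sigma)$ is a $2$-cell $\alpha:F\Rightarrow G$ such that $T'\alpha\cdot\tau=\sigma\cdot\alpha T$. Let $\mathrm{Mnd}(\mathcal D)$ be the $2$-category of monads in $\mathcal D$, colax morphisms and transformations, and let $\iota:\mathcal D\to\mathrm{Mnd}(\mathcal D)$ be the $2$-functor that sends an object to the identity monad on it. A monad $T$ admits a Kleisli object if the $2$-functor $\mathrm{Mnd}(\mathcal D)(T,\iota(-)):\mathcal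 D\to \mathrm{Cat}$ is representable. The $2$-category $\mathcal D$ admits Kleisli objects if $\iota$ has a left $2$-adjoint. Corollary. Let $\mathcal D$ be a $2$-category. Then $\mathcal D$ admits Kleisli objects if and only if every $2$-functor $\mathbf T:\mathbf\Delta\to\mathcal D$ has a $W_r$-weighted colimit. Likewise, every monad in $\mathcal D$ admits a Kleisli object if and only if every $2$-functor $\mathbf T:\mathbf\Delta\to\mathcal D$ has a $W_r$-weighted colimit. -/

import Mathlib

open CategoryTheory Bicategory Opposite

universe w v u w₁ v₁ u₁ w₂ v₂ u₂

namespace TwoDim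

theorem unop2_eqToHom {B : Type u} [Bicategory.{w, v} B] {a b : Bᵒᵖ} {f g : a ⟶ b} (h : f = g) :
    (eqToHom h).unop2 = eqToHom (congrArg Quiver.Hom.unop h) := by
  subst h; rfl

theorem hom2_ext {B : Type u} [Bicategory.{w, v} B] {a b : Bᵒᵖ} {f g : a ⟶ b} (η θ : f ⟶ g)
    (h : η.unop2 = θ.unop2) : η = θ :=
  congrArg Bicategory.Opposite.Hom2.op2' h

instance strictOp (B : Type u) [Bicategory.{w, v} B] [Bicategory.Strict B] :
    Bicategory.Strict Bᵒᵖ where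
  id_comp f := Quiver.Hom.unop_inj (Strict.comp_id f.unop)
  comp_id f := Quiver.Hom.unop_inj (Strict.id_comp f.unop)
  assoc f g h := Quiver.Hom.unop_inj (Strict.assoc h.unop g.unop f.unop).symm
  leftUnitor_eqToIso f := by
    ext; apply hom2_ext
    simp [unop2_eqToHom, Strict.rightUnitor_eqToIso]
  rightUnitor_eqToIso f := by
    ext; apply hom2_ext
    simp [unop2_eqToHom, Strict.leftUnitor_eqToIso]
  associator_eqToIso f g h := by
    ext; apply hom2_ext
    simp [unop2_eqToHom, Strict.associator_eqToIso]

/-- Build a `2`-functor with values in `Cat` from unbundled functors and transformations. -/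
def mkCatFunctor {B : Type u} [Bicategory.{w, v} B] [Bicategory.Strict B]
    (obj : B → Type u₁) [∀ X, Category.{v₁} (obj X)]
    (map : ∀ {X Y : B}, (X ⟶ Y) → (obj X ⥤ obj Y))
    (map₂ : ∀ {X Y : B} {f g : X ⟶ Y}, (f ⟶ g) → (map f ⟶ map g))
    (map₂_id : ∀ {X Y : B} (f : X ⟶ Y), map₂ (𝟙 f) = 𝟙 (map f))
    (map₂_comp : ∀ {X Y : B} {f g h : X ⟶ Y} (η : f ⟶ g) (θ : g ⟶ h),
      map₂ (η ≫ θ) = map₂ η ≫ map₂ θ)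
    (map_id : ∀ X : B, map (𝟙 X) = 𝟭 (obj X))
    (map_comp : ∀ {X Y Z : B} (f : X ⟶ Y) (g : Y ⟶ Z), map (f ≫ g) = map f ⋙ map g)
    (map₂_whisker_left : ∀ {X Y Z : B} (f : X ⟶ Y) {g g' : Y ⟶ Z} (η : g ⟶ g') (x : obj X),
      (map₂ (f ◁ η)).app x = eqToHom (congrArg (fun F => F.obj x) (map_comp f g)) ≫
        (map₂ η).app ((map f).obj x) ≫
          eqToHom (congrArg (fun F => F.obj x) (map_comp f g').symm))
    (map₂_whisker_right : ∀ {X Y Z : B} {f f' : X ⟶ Y} (η : f ⟶ f') (g : Y ⟶ Z) (x : obj X),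
      (map₂ (η ▷ g)).app x = eqToHom (congrArg (fun F => F.obj x) (map_comp f g)) ≫
        (map g).map ((map₂ η).app x) ≫
          eqToHom (congrArg (fun F => F.obj x) (map_comp f' g).symm)) :
    StrictPseudofunctor B Cat.{v₁, u₁} :=
  StrictPseudofunctor.mk''
    { obj := fun X => Cat.of (obj X)
      map := fun f => (map f).toCatHom
      map₂ := fun η => (map₂ η).toCatHom₂
      map₂_id := fun f => congrArg NatTrans.toCatHom₂ (map₂_id f)
      map₂_comp := fun η θ => congrArg NatTrans.toCatHom₂ (map₂_comp η θ)
      map_id := fun X => congrArg Functor.toCatHom (map_id X)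
      map_comp := fun f g => congrArg Functor.toCatHom (map_comp f g)
      map₂_whisker_left := fun f g g' η => by
        ext x
        refine (map₂_whisker_left f η x).trans ?_
        simp only [Cat.Hom.toNatTrans_comp, Cat.Hom₂.eqToHom_toNatTrans]
        erw [NatTrans.comp_app, NatTrans.comp_app, eqToHom_app, eqToHom_app]
        rfl
      map₂_whisker_right := fun η g => by
        ext x
        refine (map₂_whisker_right η g x).trans ?_
        simp only [Cat.Hom.toNatTrans_comp, Cat.Hom₂.eqToHom_toNatTrans]
        erw [NatTrans.comp_app, NatTrans.comp_app, eqToHom_app, eqToHom_app]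
        rfl }

section HomFunctors

variable {B : Type u} [Bicategory.{w, v} B] [Bicategory.Strict B]

/-- The representable `2`-functor `B(A, -) : B ⥤ Cat`. -/
def homFrom (A : B) : StrictPseudofunctor B Cat.{w, v} :=
  mkCatFunctor (fun X => A ⟶ X) (fun f => postcomp A f)
    (fun η => (postcomposing A _ _).map η)
    (fun f => by simp; rfl)
    (fun η θ => by simp; rfl)
    (fun X => CategoryTheory.Functor.ext (fun f => Strict.comp_id f)
        (fun f g η => by simp [Strict.rightUnitor_eqToIso]; rfl))
    (fun f g => CategoryTheory.Functor.ext
        (fun h => (Strict.assoc h f g).symm)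
        (fun h k η => by simp [Strict.associator_eqToIso]; rfl))
    (fun f g g' η h => by
      change h ◁ f ◁ η = eqToHom (Strict.assoc h f g).symm ≫ (h ≫ f) ◁ η ≫
        eqToHom (Strict.assoc h f g')
      simp [Strict.associator_eqToIso])
    (fun {_ _ _ f f'} η g h => by
      change h ◁ η ▷ g = eqToHom (Strict.assoc h f g).symm ≫ (h ◁ η) ▷ g ≫
        eqToHom (Strict.assoc h f' g)
      simp [Strict.associator_eqToIso])

variable {I : Type u₁} [Bicategory.{w₁, v₁} I] [Bicategory.Strict I]

/-- The `2`-functor `B(T(-), X) : Iᵒᵖ ⥤ Cat`, where `Iᵒᵖ` has the `1`-cells reversed. -/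
def homInto (T : StrictPseudofunctor I B) (X : B) : StrictPseudofunctor Iᵒᵖ Cat.{w, v} :=
  mkCatFunctor (fun i => T.obj i.unop ⟶ X) (fun f => precomp X (T.map f.unop))
    (fun η => (precomposing _ _ X).map (T.map₂ η.unop2))
    (fun f => by simp; rfl)
    (fun η θ => by simp; rfl)
    (fun i => CategoryTheory.Functor.ext
      (fun f => by simp [T.map_id])
      (fun f g η => by simp [congr_whiskerLeft (T.map_id _), Strict.leftUnitor_eqToIso]; rfl))
    (fun f g => CategoryTheory.Functor.ext
      (fun h => by simp [T.map_comp])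
      (fun h k η => by simp [congr_whiskerLeft (T.map_comp _ _), Strict.associator_eqToIso]; rfl))
    (fun {_ _ _} f {g g'} η h => by
      change T.map₂ (η.unop2 ▷ f.unop) ▷ h =
        eqToHom (show T.map (g.unop ≫ f.unop) ≫ h = T.map g.unop ≫ T.map f.unop ≫ h by
          rw [T.map_comp, Strict.assoc]) ≫ T.map₂ η.unop2 ▷ (T.map f.unop ≫ h) ≫
        eqToHom (show T.map g'.unop ≫ T.map f.unop ≫ h = T.map (g'.unop ≫ f.unop) ≫ h by
          rw [T.map_comp, Strict.assoc])
      simp [T.mapComp_eq_eqToIso, Strict.associator_eqToIso])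
    (fun {_ _ _ f f'} η g h => by
      change T.map₂ (g.unop ◁ η.unop2) ▷ h =
        eqToHom (show T.map (g.unop ≫ f.unop) ≫ h = T.map g.unop ≫ T.map f.unop ≫ h by
          rw [T.map_comp, Strict.assoc]) ≫ T.map g.unop ◁ T.map₂ η.unop2 ▷ h ≫
        eqToHom (show T.map g.unop ≫ T.map f'.unop ≫ h = T.map (g.unop ≫ f'.unop) ≫ h by
          rw [T.map_comp, Strict.assoc])
      simp [T.mapComp_eq_eqToIso, Strict.associator_eqToIso])

end HomFunctors

section CatNat

variable {B : Type u} [Bicategory.{w, v} B]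

/-- A `2`-natural transformation between `2`-functors with values in categories.  The two
`2`-functors may take values in categories of different universe levels. -/
structure CatNat (F : StrictPseudofunctor B Cat.{v₁, u₁})
    (G : StrictPseudofunctor B Cat.{v₂, u₂}) where
  app (X : B) : F.obj X ⥤ G.obj X
  naturality {X Y : B} (f : X ⟶ Y) :
    (F.map f).toFunctor ⋙ app Y = app X ⋙ (G.map f).toFunctor
  naturality₂ {X Y : B} {f g : X ⟶ Y} (η : f ⟶ g) (x : F.obj X) :
    (app Y).map ((F.map₂ η).toNatTrans.app x) =
      eqToHom (Functor.congr_obj (naturality f) x) ≫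
        (G.map₂ η).toNatTrans.app ((app X).obj x) ≫
          eqToHom (Functor.congr_obj (naturality g) x).symm

variable {F : StrictPseudofunctor B Cat.{v₁, u₁}} {G : StrictPseudofunctor B Cat.{v₂, u₂}}

namespace CatNat

/-- A modification between `2`-natural transformations. -/
@[ext]
structure Modification (α β : CatNat F G) where
  app (X : B) : α.app X ⟶ β.app X
  naturality {X Y : B} (f : X ⟶ Y) (x : F.obj X) :
    (app Y).app ((F.map f).toFunctor.obj x) =
      eqToHom (Functor.congr_obj (α.naturality f) x) ≫
        (G.map f).toFunctor.map ((app X).app x) ≫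
          eqToHom (Functor.congr_obj (β.naturality f) x).symm

instance : Category (CatNat F G) where
  Hom := Modification
  id α := { app := fun X => 𝟙 _, naturality := fun f x => by simp }
  comp m n :=
    { app := fun X => m.app X ≫ n.app X
      naturality := fun f x => by simp [m.naturality, n.naturality] }

@[ext]
theorem hom_ext {α β : CatNat F G} {m n : α ⟶ β} (h : ∀ X, m.app X = n.app X) : m = n :=
  Modification.ext (funext h)

@[simp] theorem id_app (α : CatNat F G) (X : B) : Modification.app (𝟙 α) X = 𝟙 (α.app X) := rfl

@[simp] theorem comp_app {α β γ : CatNat F G} (m : α ⟶ β) (n : β ⟶ γ) (X : B) :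
    (m ≫ n).app X = m.app X ≫ n.app X := rfl

theorem eqToHom_app {α β : CatNat F G} (h : α = β) (X : B) :
    Modification.app (eqToHom h) X = eqToHom (congrArg (fun γ => γ.app X) h) := by
  subst h; rfl

theorem conj_app {α α' β β' : CatNat F G} (h : α = α') (m : α' ⟶ β') (h' : β' = β) (X : B)
    (x : F.obj X) : (Modification.app (eqToHom h ≫ m ≫ eqToHom h') X).app x =
      eqToHom (congrArg (fun γ => (γ.app X).obj x) h) ≫ (m.app X).app x ≫
        eqToHom (congrArg (fun γ => (γ.app X).obj x) h') := by
  subst h; subst h'; simp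

theorem ext_app {α β : CatNat F G} (h : ∀ X, α.app X = β.app X) : α = β := by
  cases α; cases β
  congr
  exact funext h

end CatNat

/-- An isomorphism of `2`-functors with values in categories: a `2`-natural transformation whose
components are isomorphisms of categories. -/
structure CatNatIso (F : StrictPseudofunctor B Cat.{v₁, u₁})
    (G : StrictPseudofunctor B Cat.{v₂, u₂}) extends CatNat F G where
  inv (X : B) : G.obj X ⥤ F.obj X
  app_inv (X : B) : app X ⋙ inv X = 𝟭 (F.obj X)
  inv_app (X : B) : inv X ⋙ app X = 𝟭 (G.obj X)

/-- A `2`-functor is representable if it is isomorphic to `B(A, -)` for some object `A`. -/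
def IsRepresentable [Bicategory.Strict B] (G : StrictPseudofunctor B Cat.{v₂, u₂}) : Prop :=
  ∃ A : B, Nonempty (CatNatIso (homFrom A) G)

end CatNat

section WeightedColimits

variable {I : Type u₁} [Bicategory.{w₁, v₁} I] [Bicategory.Strict I]
  {D : Type u} [Bicategory.{w, v} D] [Bicategory.Strict D]

theorem comp_eq {a b X Y : D} {p : a ⟶ X} {t : a ⟶ b} {q : b ⟶ X} (h : p = t ≫ q)
    (f : X ⟶ Y) : p ≫ f = t ≫ q ≫ f := by
  rw [h, Strict.assoc]

theorem whisker_conj_right {a b X Y : D} {p p' : a ⟶ X} {t t' : a ⟶ b} {q : b ⟶ X}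
    (h : p = t ≫ q) (h' : p' = t' ≫ q) (σ : t ⟶ t') (f : X ⟶ Y) :
    (eqToHom h ≫ σ ▷ q ≫ eqToHom h'.symm) ▷ f =
      eqToHom (comp_eq h f) ≫ σ ▷ (q ≫ f) ≫ eqToHom (comp_eq h' f).symm := by
  subst h; subst h'
  simp [Strict.associator_eqToIso]

theorem whisker_conj_left {a b X Y : D} {p p' : a ⟶ X} {t : a ⟶ b} {q q' : b ⟶ X}
    (h : p = t ≫ q) (h' : p' = t ≫ q') (σ : q ⟶ q') (f : X ⟶ Y) :
    (eqToHom h ≫ t ◁ σ ≫ eqToHom h'.symm) ▷ f =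
      eqToHom (comp_eq h f) ≫ t ◁ σ ▷ f ≫ eqToHom (comp_eq h' f).symm := by
  subst h; subst h'
  simp [Strict.associator_eqToIso]

theorem whisker_conj {a b X Y : D} {p : a ⟶ X} {t : a ⟶ b} {q : b ⟶ X} (h : p = t ≫ q)
    {f g : X ⟶ Y} (η : f ⟶ g) :
    p ◁ η = eqToHom (comp_eq h f) ≫ t ◁ q ◁ η ≫ eqToHom (comp_eq h g).symm := by
  subst h
  simp [Strict.associator_eqToIso]

theorem whiskerRight_id_conj {a X : D} {p q : a ⟶ X} (σ : p ⟶ q) :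
    σ ▷ 𝟙 X = eqToHom (Strict.comp_id p) ≫ σ ≫ eqToHom (Strict.comp_id q).symm := by
  simp [Strict.rightUnitor_eqToIso]

theorem whiskerRight_comp_conj {a X Y Z : D} {p q : a ⟶ X} (σ : p ⟶ q) (f : X ⟶ Y)
    (g : Y ⟶ Z) : σ ▷ (f ≫ g) =
      eqToHom (Strict.assoc p f g).symm ≫ σ ▷ f ▷ g ≫ eqToHom (Strict.assoc q f g) := by
  simp [Strict.associator_eqToIso]

theorem whisker_assoc_conj {a X Y Z : D} (p : a ⟶ X) {f f' : X ⟶ Y} (σ : f ⟶ f')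
    (g : Y ⟶ Z) : p ◁ σ ▷ g =
      eqToHom (Strict.assoc p f g).symm ≫ (p ◁ σ) ▷ g ≫ eqToHom (Strict.assoc p f' g) := by
  simp [Strict.associator_eqToIso]

theorem whisker_assoc_conj' {a X Y Z : D} (p : a ⟶ X) {f f' : X ⟶ Y} (σ : f ⟶ f')
    (g : Y ⟶ Z) : (p ◁ σ) ▷ g =
      eqToHom (Strict.assoc p f g) ≫ p ◁ σ ▷ g ≫ eqToHom (Strict.assoc p f' g).symm := by
  simp [Strict.associator_eqToIso]

theorem whiskerLeft_comp_conj {a X Y Z : D} (p : a ⟶ X) (f : X ⟶ Y) {g g' : Y ⟶ Z}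
    (σ : g ⟶ g') : p ◁ f ◁ σ =
      eqToHom (Strict.assoc p f g).symm ≫ (p ≫ f) ◁ σ ≫ eqToHom (Strict.assoc p f g') := by
  simp [Strict.associator_eqToIso]

theorem postcomp_precomp {a b c d : D} (h : a ⟶ b) (f : c ⟶ d) :
    precomp c h ⋙ postcomp a f = postcomp b f ⋙ precomp d h :=
  CategoryTheory.Functor.ext (fun k => Strict.assoc h k f)
    (fun _ _ η => whisker_assoc_conj' h η f)

theorem postcomp_id (A X : D) : postcomp A (𝟙 X) = 𝟭 (A ⟶ X) :=
  CategoryTheory.Functor.ext (fun f => Strict.comp_id f) (fun _ _ η => whiskerRight_id_conj η)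

theorem postcomp_comp (A : D) {X Y Z : D} (f : X ⟶ Y) (g : Y ⟶ Z) :
    postcomp A (f ≫ g) = postcomp A f ⋙ postcomp A g :=
  CategoryTheory.Functor.ext (fun k => (Strict.assoc k f g).symm)
    (fun _ _ η => whiskerRight_comp_conj η f g)

/-- A `1`-cell `f : X ⟶ Y` sends a cocone with vertex `X` to one with vertex `Y`. -/
def coconeMap (W : StrictPseudofunctor Iᵒᵖ Cat.{v₂, u₂}) (T : StrictPseudofunctor I D)
    {X Y : D} (f : X ⟶ Y) : CatNat W (homInto T X) ⥤ CatNat W (homInto T Y) where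
  obj α :=
    { app := fun i => α.app i ⋙ postcomp (T.obj i.unop) f
      naturality := fun {i j} k =>
        (congrArg (fun H => H ⋙ postcomp (T.obj j.unop) f) (α.naturality k)).trans
          (congrArg (fun H => α.app i ⋙ H) (postcomp_precomp (T.map k.unop) f))
      naturality₂ := fun {_ _} k l η x =>
        (congrArg (fun σ => σ ▷ f) (α.naturality₂ η x)).trans
          (whisker_conj_right (Functor.congr_obj (α.naturality k) x)
            (Functor.congr_obj (α.naturality l) x) (T.map₂ η.unop2) f) }
  map {α β} m :=
    { app := fun i => Functor.whiskerRight (m.app i) (postcomp (T.obj i.unop) f)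
      naturality := fun {i _} k x =>
        (congrArg (fun σ => σ ▷ f) (m.naturality k x)).trans
          (whisker_conj_left (Functor.congr_obj (α.naturality k) x)
            (Functor.congr_obj (β.naturality k) x) ((m.app i).app x) f) }
  map_id α := by
    ext i x
    exact id_whiskerRight _ _
  map_comp m n := by
    ext i x
    exact comp_whiskerRight _ _ _

/-- A `2`-cell `η : f ⟶ g` induces the modifications with components `x ↦ (α x) ◁ η`. -/
def coconeMap₂ (W : StrictPseudofunctor Iᵒᵖ Cat.{v₂, u₂}) (T : StrictPseudofunctor I D)
    {X Y : D} {f g : X ⟶ Y} (η : f ⟶ g) : coconeMap W T f ⟶ coconeMap W T g where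
  app α :=
    { app := fun i => Functor.whiskerLeft (α.app i) ((postcomposing (T.obj i.unop) X Y).map η)
      naturality := fun {_ _} k x => whisker_conj (Functor.congr_obj (α.naturality k) x) η }
  naturality {α β} m := by
    ext i x
    exact (whisker_exchange ((m.app i).app x) η).symm

/-- The `2`-functor `D ⥤ Cat` sending `X` to the category of `W`-weighted cocones under `T`
with vertex `X`: `2`-natural transformations `W ⟶ D(T(-), X)` and their modifications. -/
def cocone (W : StrictPseudofunctor Iᵒᵖ Cat.{v₂, u₂}) (T : StrictPseudofunctor I D) :
    StrictPseudofunctor D Cat.{max u₁ u₂ w, max u₁ v₂ u₂ w v} :=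
  mkCatFunctor (fun X : D => CatNat W (homInto T X)) (coconeMap W T) (coconeMap₂ W T)
    (fun f => by
      ext α i x
      exact whiskerLeft_id _ _)
    (fun η θ => by
      ext α i x
      exact whiskerLeft_comp _ _ _)
    (fun X => CategoryTheory.Functor.ext
      (fun α => CatNat.ext_app fun i => congrArg (fun H => α.app i ⋙ H) (postcomp_id _ X))
      (fun α β m => by
        ext i x
        refine Eq.trans ?_ (CatNat.conj_app _ _ _ i x).symm
        exact whiskerRight_id_conj _))
    (fun f g => CategoryTheory.Functor.ext
      (fun α => CatNat.ext_app fun i => congrArg (fun H => α.app i ⋙ H) (postcomp_comp _ f g))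
      (fun α β m => by
        ext i x
        refine Eq.trans ?_ (CatNat.conj_app _ _ _ i x).symm
        exact whiskerRight_comp_conj _ f g))
    (fun f g g' η α => by
      ext i x
      refine Eq.trans ?_ (CatNat.conj_app _ _ _ i x).symm
      exact whiskerLeft_comp_conj _ f η)
    (fun η g α => by
      ext i x
      refine Eq.trans ?_ (CatNat.conj_app _ _ _ i x).symm
      exact whisker_assoc_conj _ η g)

/-- `T` has a `W`-weighted colimit: the `2`-functor of `W`-weighted cocones is representable. -/
def HasWeightedColimit (W : StrictPseudofunctor Iᵒᵖ Cat.{v₂, u₂})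
    (T : StrictPseudofunctor I D) : Prop :=
  IsRepresentable (cocone W T)

end WeightedColimits

section Simplicial

/-- Objects of the simplicial category `Δ`: the finite ordinals `n = {0, …, n - 1}`,
including `0`. -/
@[ext]
structure Del where
  card : ℕ

namespace Del

/-- Morphisms of `Δ`: monotone maps. -/
@[ext]
structure Hom (m n : Del) where
  toFun : Fin m.card → Fin n.card
  mono : Monotone toFun

instance : Category Del where
  Hom := Hom
  id n := ⟨id, monotone_id⟩
  comp f g := ⟨g.toFun ∘ f.toFun, g.mono.comp f.mono⟩

theorem hom_ext {m n : Del} {f g : m ⟶ n} (h : ∀ i, (f.toFun i).val = (g.toFun i).val) :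
    f = g :=
  Hom.ext (funext fun i => Fin.ext (h i))

@[simp] theorem id_toFun (n : Del) (i : Fin n.card) : Hom.toFun (𝟙 n) i = i := rfl

@[simp] theorem comp_toFun {k m n : Del} (f : k ⟶ m) (g : m ⟶ n) (i : Fin k.card) :
    (f ≫ g).toFun i = g.toFun (f.toFun i) := rfl

theorem eqToHom_val {m n : Del} (h : m = n) (i : Fin m.card) :
    (Hom.toFun (eqToHom h) i).val = i.val := by
  subst h; rfl

theorem eqToHom_mk {m n : Del} (h : m = n) (i : ℕ) (hi : i < m.card) :
    Hom.toFun (eqToHom h) ⟨i, hi⟩ = ⟨i, h ▸ hi⟩ := by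
  subst h; rfl

/-- The ordinal sum of objects. -/
def sum (m n : Del) : Del := ⟨m.card + n.card⟩

@[simp] theorem sum_card (m n : Del) : (sum m n).card = m.card + n.card := rfl

/-- The ordinal sum `f + g` of two monotone maps: `f` on the first summand, `g` on the second. -/
def sumHom {m m' n n' : Del} (f : m ⟶ m') (g : n ⟶ n') : sum m n ⟶ sum m' n' where
  toFun i :=
    if h : i.val < m.card then
      ⟨(f.toFun ⟨i.val, h⟩).val, Nat.lt_add_right _ (f.toFun ⟨i.val, h⟩).isLt⟩
    else
      ⟨m'.card + (g.toFun ⟨i.val - m.card, by have := i.isLt; simp at this; omega⟩).val,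
        Nat.add_lt_add_left (Fin.isLt _) _⟩
  mono i j hij := by
    rw [Fin.le_def] at hij ⊢
    dsimp only
    split_ifs with h₁ h₂ h₂
    · exact f.mono (show (⟨i.val, h₁⟩ : Fin m.card) ≤ ⟨j.val, h₂⟩ from hij)
    · exact (f.toFun ⟨i.val, h₁⟩).isLt.le.trans (Nat.le_add_right _ _)
    · omega
    · exact Nat.add_le_add_left (g.mono (Fin.mk_le_mk.2 (Nat.sub_le_sub_right hij _))) _

theorem sumHom_val {m m' n n' : Del} (f : m ⟶ m') (g : n ⟶ n') (i : Fin (sum m n).card) :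
    ((sumHom f g).toFun i).val =
      if h : i.val < m.card then (f.toFun ⟨i.val, h⟩).val
      else m'.card + (g.toFun ⟨i.val - m.card, by have := i.isLt; simp at this; omega⟩).val := by
  unfold sumHom
  split_ifs <;> simp_all

theorem sumHom_lt {m m' n n' : Del} (f : m ⟶ m') (g : n ⟶ n') {i : ℕ}
    (hi : i < (sum m n).card) (h : i < m.card) :
    ((sumHom f g).toFun ⟨i, hi⟩).val = (f.toFun ⟨i, h⟩).val := by
  rw [sumHom_val, dif_pos h]

theorem sumHom_ge {m m' n n' : Del} (f : m ⟶ m') (g : n ⟶ n') {i : ℕ}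
    (hi : i < (sum m n).card) (h : m.card ≤ i) (h' : i - m.card < n.card) :
    ((sumHom f g).toFun ⟨i, hi⟩).val = m'.card + (g.toFun ⟨i - m.card, h'⟩).val := by
  rw [sumHom_val, dif_neg (Nat.not_lt.2 h)]

theorem zero_sum (m : Del) : sum ⟨0⟩ m = m := Del.ext (Nat.zero_add _)

theorem sum_zero (m : Del) : sum m ⟨0⟩ = m := rfl

theorem sum_assoc (k m n : Del) : sum (sum k m) n = sum k (sum m n) :=
  Del.ext (Nat.add_assoc _ _ _)

theorem sumHom_id (m n : Del) : sumHom (𝟙 m) (𝟙 n) = 𝟙 (sum m n) := by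
  apply hom_ext; intro i
  rw [sumHom_val]
  split_ifs <;> simp
  omega

theorem sumHom_comp {k m n k' m' n' : Del} (f : k ⟶ m) (g : m ⟶ n) (f' : k' ⟶ m')
    (g' : m' ⟶ n') : sumHom (f ≫ g) (f' ≫ g') = sumHom f f' ≫ sumHom g g' := by
  apply hom_ext; intro i
  simp only [sumHom_val, comp_toFun]
  split_ifs with h₁ h₂ h₂
  · rfl
  · exact absurd (Fin.isLt _) h₂
  · omega
  · simp

theorem sumHom_assoc {k m n k' m' n' : Del} (f : k ⟶ k') (g : m ⟶ m') (h : n ⟶ n') :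
    sumHom (sumHom f g) h ≫ eqToHom (sum_assoc k' m' n') =
      eqToHom (sum_assoc k m n) ≫ sumHom f (sumHom g h) := by
  apply hom_ext
  rintro ⟨i, hi⟩
  have hi' : i < k.card + m.card + n.card := hi
  rw [comp_toFun, comp_toFun, eqToHom_val, eqToHom_mk]
  by_cases h₁ : i < k.card
  · rw [sumHom_lt _ _ _ (show i < (sum k m).card by rw [sum_card]; omega), sumHom_lt _ _ _ h₁,
      sumHom_lt _ _ _ h₁]
  · rw [sumHom_ge f (sumHom g h) _ (by omega) (by rw [sum_card]; omega)]
    by_cases h₂ : i < k.card + m.card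
    · rw [sumHom_lt _ _ _ (show i < (sum k m).card from h₂),
        sumHom_ge _ _ _ (by omega) (by omega), sumHom_lt _ _ _ (by omega)]
    · rw [sumHom_ge _ _ _ (show (sum k m).card ≤ i by rw [sum_card]; omega)
        (by rw [sum_card]; omega), sumHom_ge _ _ _ (by omega) (by omega)]
      simp only [sum_card, Nat.sub_sub, Nat.add_assoc]

theorem sumHom_assoc_left {k m n k' m' n' : Del} (f : k ⟶ k') (g : m ⟶ m') (h : n ⟶ n') :
    sumHom f (sumHom g h) = eqToHom (sum_assoc k m n).symm ≫ sumHom (sumHom f g) h ≫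
      eqToHom (sum_assoc k' m' n') := by
  simp [sumHom_assoc]

theorem sumHom_eqToHom_left {m m' : Del} (h : m = m') (n : Del) :
    sumHom (eqToHom h) (𝟙 n) = eqToHom (congrArg (fun k => sum k n) h) := by
  subst h; exact sumHom_id _ _

theorem sumHom_eqToHom_right {m m' : Del} (h : m = m') (n : Del) :
    sumHom (𝟙 n) (eqToHom h) = eqToHom (congrArg (fun k => sum n k) h) := by
  subst h; exact sumHom_id _ _

theorem zero_sumHom {m n : Del} (f : m ⟶ n) :
    sumHom (𝟙 (⟨0⟩ : Del)) f = eqToHom (zero_sum m) ≫ f ≫ eqToHom (zero_sum n).symm := by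
  apply hom_ext; intro i
  simp only [sumHom_val, comp_toFun, eqToHom_val, Nat.not_lt_zero, dite_false, Nat.zero_add]
  congr 2
  exact Fin.ext (eqToHom_val (zero_sum m) i).symm

theorem sumHom_zero {m n : Del} (f : m ⟶ n) : sumHom f (𝟙 (⟨0⟩ : Del)) = f := by
  apply hom_ext; intro i
  rw [sumHom_val, dif_pos (show i.val < m.card from i.isLt)]
  rfl

end Del

/-- The one-object `2`-category whose `1`-cells are the objects of `Δ` and whose `2`-cells are
the morphisms of `Δ`. -/
inductive BDel : Type
  | star

namespace BDel

/-- The composite `n ∘ m` of `1`-cells (written `m ≫ n`) is the ordinal sum `n + m`, and the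
horizontal composite `g ∘ f` of `2`-cells is the ordinal sum `g + f`. -/
instance : Bicategory BDel where
  Hom _ _ := Del
  id _ := ⟨0⟩
  comp m n := Del.sum n m
  homCategory _ _ := inferInstanceAs (Category Del)
  whiskerLeft m _ _ f := Del.sumHom f (𝟙 m)
  whiskerRight f n := Del.sumHom (𝟙 n) f
  associator k m n := eqToIso (Del.sum_assoc n m k).symm
  leftUnitor m := eqToIso (Del.sum_zero m)
  rightUnitor m := eqToIso (Del.zero_sum m)
  whiskerLeft_id _ _ := Del.sumHom_id _ _
  whiskerLeft_comp m _ _ _ f g := by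
    have := Del.sumHom_comp f g (𝟙 m) (𝟙 m)
    rwa [Category.id_comp] at this
  id_whiskerLeft f := by
    change Del.sumHom f (𝟙 _) = eqToHom (Del.sum_zero _) ≫ f ≫ eqToHom (Del.sum_zero _).symm
    rw [Del.sumHom_zero]
    exact ((Category.id_comp _).trans (Category.comp_id _)).symm
  comp_whiskerLeft k m _ _ f := by
    have := Del.sumHom_assoc_left f (𝟙 m) (𝟙 k)
    rwa [Del.sumHom_id] at this
  id_whiskerRight _ _ := Del.sumHom_id _ _
  comp_whiskerRight f g n := by
    have := Del.sumHom_comp (𝟙 n) (𝟙 n) f g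
    rwa [Category.id_comp] at this
  whiskerRight_id f := Del.zero_sumHom f
  whiskerRight_comp {_ _ _ _ f f'} η m n := by
    change Del.sumHom (𝟙 (Del.sum n m)) η = eqToHom (Del.sum_assoc n m f) ≫
      Del.sumHom (𝟙 n) (Del.sumHom (𝟙 m) η) ≫ eqToHom (Del.sum_assoc n m f').symm
    rw [Del.sumHom_assoc_left, Del.sumHom_id]
    simp
  whisker_assoc k _ _ f n := Del.sumHom_assoc_left (𝟙 n) f (𝟙 k)
  whisker_exchange {_ _ _ f g h i} η θ := by
    change Del.sumHom θ (𝟙 f) ≫ Del.sumHom (𝟙 i) η = Del.sumHom (𝟙 h) η ≫ Del.sumHom θ (𝟙 g)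
    simp [← Del.sumHom_comp]
  pentagon k l m n := by
    change Del.sumHom (𝟙 n) (eqToHom (Del.sum_assoc m l k).symm) ≫
      eqToHom (Del.sum_assoc n (Del.sum m l) k).symm ≫
      Del.sumHom (eqToHom (Del.sum_assoc n m l).symm) (𝟙 k) =
      eqToHom (Del.sum_assoc n m (Del.sum l k)).symm ≫
      eqToHom (Del.sum_assoc (Del.sum n m) l k).symm
    simp [Del.sumHom_eqToHom_left, Del.sumHom_eqToHom_right]
  triangle m n := by
    change eqToHom (Del.sum_assoc n ⟨0⟩ m).symm ≫ Del.sumHom (eqToHom (Del.sum_zero n)) (𝟙 m) =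
      Del.sumHom (𝟙 n) (eqToHom (Del.zero_sum m))
    simp [Del.sumHom_eqToHom_left, Del.sumHom_eqToHom_right]

instance : Bicategory.Strict BDel where
  id_comp m := Del.sum_zero m
  comp_id m := Del.zero_sum m
  assoc k m n := (Del.sum_assoc n m k).symm

end BDel

end Simplicial

section PartialSimplicial

/-- Objects of the right partial simplicial category `Π_r`: the finite ordinals. -/
@[ext]
structure PiR where
  card : ℕ

namespace PiR

/-- Morphisms of `Π_r`: partial monotone maps (`none` means undefined) which, when defined at `i`,
are defined at every `j ≥ i`. -/
@[ext]
structure Hom (m n : PiR) where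
  toFun : Fin m.card → Option (Fin n.card)
  mono : ∀ ⦃i j : Fin m.card⦄ ⦃a b : Fin n.card⦄, i ≤ j → toFun i = some a → toFun j = some b →
    a ≤ b
  upper : ∀ ⦃i j : Fin m.card⦄, i ≤ j → (toFun i).isSome → (toFun j).isSome

instance : Category PiR where
  Hom := Hom
  id n :=
    { toFun := some
      mono := fun i j a b h ha hb => by
        cases ha; cases hb; exact h
      upper := fun _ _ _ _ => rfl }
  comp f g :=
    { toFun := fun i => (f.toFun i).bind g.toFun
      mono := fun i j a b h ha hb => by
        obtain ⟨a', ha', ha⟩ := Option.bind_eq_some_iff.1 ha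
        obtain ⟨b', hb', hb⟩ := Option.bind_eq_some_iff.1 hb
        exact g.mono (f.mono h ha' hb') ha hb
      upper := fun i j h hi => by
        obtain ⟨a, ha⟩ := Option.isSome_iff_exists.1 hi
        obtain ⟨a', ha', ha⟩ := Option.bind_eq_some_iff.1 ha
        obtain ⟨b', hb'⟩ := Option.isSome_iff_exists.1 (f.upper h (by simp [ha']))
        rw [hb']
        exact g.upper (f.mono h ha' hb') (by simp [ha]) }
  id_comp f := Hom.ext (funext fun i => rfl)
  comp_id f := Hom.ext (funext fun i => Option.bind_fun_some _)
  assoc f g h := Hom.ext (funext fun i => Option.bind_assoc _ _ _)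

theorem id_toFun (n : PiR) (i : Fin n.card) : Hom.toFun (𝟙 n) i = some i := rfl

theorem comp_toFun {k m n : PiR} (f : k ⟶ m) (g : m ⟶ n) (i : Fin k.card) :
    (f ≫ g).toFun i = (f.toFun i).bind g.toFun := rfl

theorem eqToHom_toFun {m n : PiR} (h : m = n) (i : Fin m.card) :
    Hom.toFun (eqToHom h) i = some ⟨i.val, h ▸ i.isLt⟩ := by
  subst h; rfl

/-- The object `k + n` of `Π_r`. -/
def add (k : PiR) (n : Del) : PiR := ⟨k.card + n.card⟩

@[simp] theorem add_card (k : PiR) (n : Del) : (add k n).card = k.card + n.card := rfl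

/-- The ordinal sum `g + f` of a morphism `g` of `Π_r` and a (total) monotone map `f`. -/
def addHom {k k' : PiR} {n n' : Del} (g : k ⟶ k') (f : n ⟶ n') : add k n ⟶ add k' n' where
  toFun i :=
    if h : i.val < k.card then
      (g.toFun ⟨i.val, h⟩).map fun a => ⟨a.val, Nat.lt_add_right _ a.isLt⟩
    else
      some ⟨k'.card + (f.toFun ⟨i.val - k.card, by have := i.isLt; simp at this; omega⟩).val,
        Nat.add_lt_add_left (Fin.isLt _) _⟩
  mono i j a b hij ha hb := by
    rw [Fin.le_def] at hij
    split_ifs at ha hb with h₁ h₂ h₂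
    · obtain ⟨a', ha', rfl⟩ := Option.map_eq_some_iff.1 ha
      obtain ⟨b', hb', rfl⟩ := Option.map_eq_some_iff.1 hb
      exact g.mono (show (⟨i.val, h₁⟩ : Fin k.card) ≤ ⟨j.val, h₂⟩ from hij) ha' hb'
    · obtain ⟨a', ha', rfl⟩ := Option.map_eq_some_iff.1 ha
      cases hb
      exact a'.isLt.le.trans (Nat.le_add_right _ _)
    · omega
    · cases ha
      cases hb
      exact Nat.add_le_add_left (f.mono (Fin.mk_le_mk.2 (Nat.sub_le_sub_right hij _))) _
  upper i j hij hi := by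
    rw [Fin.le_def] at hij
    split_ifs at hi ⊢ with h₁ h₂ h₂
    · rw [Option.isSome_map] at hi ⊢
      exact g.upper (show (⟨i.val, h₂⟩ : Fin k.card) ≤ ⟨j.val, h₁⟩ from hij) hi
    · omega
    · rfl
    · rfl

theorem addHom_lt {k k' : PiR} {n n' : Del} (g : k ⟶ k') (f : n ⟶ n') {i : ℕ}
    (hi : i < (add k n).card) (h : i < k.card) :
    (addHom g f).toFun ⟨i, hi⟩ =
      (g.toFun ⟨i, h⟩).map fun a => ⟨a.val, Nat.lt_add_right _ a.isLt⟩ :=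
  dif_pos h

theorem addHom_ge {k k' : PiR} {n n' : Del} (g : k ⟶ k') (f : n ⟶ n') {i : ℕ}
    (hi : i < (add k n).card) (h : k.card ≤ i) (h' : i - k.card < n.card) :
    (addHom g f).toFun ⟨i, hi⟩ =
      some ⟨k'.card + (f.toFun ⟨i - k.card, h'⟩).val, Nat.add_lt_add_left (Fin.isLt _) _⟩ :=
  dif_neg (Nat.not_lt.2 h)

theorem hom_ext {m n : PiR} {f g : m ⟶ n} (h : ∀ i hi, f.toFun ⟨i, hi⟩ = g.toFun ⟨i, hi⟩) :
    f = g :=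
  Hom.ext (funext fun i => h i.val i.isLt)

theorem add_zero (k : PiR) : add k ⟨0⟩ = k := rfl

theorem add_assoc (k : PiR) (m n : Del) : add k (Del.sum m n) = add (add k m) n :=
  PiR.ext (Nat.add_assoc _ _ _).symm

theorem addHom_id (k : PiR) (n : Del) : addHom (𝟙 k) (𝟙 n) = 𝟙 (add k n) := by
  apply hom_ext; intro i hi
  by_cases h : i < k.card
  · rw [addHom_lt _ _ _ h]; rfl
  · have hi' : i < k.card + n.card := hi
    rw [addHom_ge _ _ _ (by omega) (by omega), id_toFun]
    simp only [Del.id_toFun, Option.some.injEq, Fin.mk.injEq]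
    omega

theorem addHom_comp {k m n : PiR} {k' m' n' : Del} (f : k ⟶ m) (g : m ⟶ n) (f' : k' ⟶ m')
    (g' : m' ⟶ n') : addHom (f ≫ g) (f' ≫ g') = addHom f f' ≫ addHom g g' := by
  apply hom_ext; intro i hi
  rw [comp_toFun]
  by_cases h : i < k.card
  · rw [addHom_lt _ _ _ h, addHom_lt _ _ _ h, comp_toFun]
    cases hf : f.toFun ⟨i, h⟩ with
    | none => rfl
    | some a => exact (addHom_lt g g' _ a.isLt).symm
  · have hi' : i < k.card + k'.card := hi
    rw [addHom_ge _ _ _ (by omega) (by omega), addHom_ge _ _ _ (by omega) (by omega),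
      Option.bind_some]
    refine Eq.trans ?_ (addHom_ge g g' _ (Nat.le_add_right _ _) (by
      rw [Nat.add_sub_cancel_left]; exact Fin.isLt _)).symm
    simp

theorem addHom_zero {k k' : PiR} (g : k ⟶ k') : addHom g (𝟙 (⟨0⟩ : Del)) = g := by
  apply hom_ext; intro i hi
  exact (addHom_lt g (𝟙 (⟨0⟩ : Del)) hi hi).trans Option.map_id'

theorem addHom_assoc {k k' : PiR} {m m' n n' : Del} (g : k ⟶ k') (f : m ⟶ m') (h : n ⟶ n') :
    addHom g (Del.sumHom f h) = eqToHom (add_assoc k m n) ≫ addHom (addHom g f) h ≫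
      eqToHom (add_assoc k' m' n').symm := by
  apply hom_ext; intro i hi
  have hi' : i < k.card + (m.card + n.card) := hi
  have key : ∀ {a b c : PiR} (p : a ⟶ b) (e : b = c) (j : Fin a.card),
      (p ≫ eqToHom e).toFun j = (p.toFun j).map fun x => ⟨x.val, e ▸ x.isLt⟩ := by
    intro a b c p e j
    subst e
    simp
  rw [comp_toFun, eqToHom_toFun, Option.bind_some, key]
  by_cases h₁ : i < k.card
  · rw [addHom_lt _ _ _ h₁, addHom_lt _ _ _ (show i < (add k m).card by rw [add_card]; omega),
      addHom_lt _ _ _ h₁, Option.map_map, Option.map_map]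
    rfl
  · rw [addHom_ge _ _ _ (by omega) (by rw [Del.sum_card]; omega)]
    by_cases h₂ : i < k.card + m.card
    · rw [addHom_lt _ _ _ (show i < (add k m).card from h₂),
        addHom_ge _ _ _ (by omega) (by omega)]
      exact congrArg some (Fin.ext (congrArg (k'.card + ·) (Del.sumHom_lt f h _ (by omega))))
    · rw [addHom_ge _ _ _ (show (add k m).card ≤ i by rw [add_card]; omega)
        (by rw [add_card]; omega)]
      refine congrArg some (Fin.ext ((congrArg (k'.card + ·)
        (Del.sumHom_ge f h _ (by omega) (by omega))).trans ?_))
      simp only [add_card, Nat.sub_sub, Nat.add_assoc]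

/-- The functor `(-) + n : Π_r ⥤ Π_r`. -/
def addFunctor (n : Del) : PiR ⥤ PiR where
  obj k := add k n
  map g := addHom g (𝟙 n)
  map_id k := addHom_id k n
  map_comp f g := by rw [← addHom_comp, Category.comp_id]

/-- The natural transformation `(-) + f : (-) + m ⟶ (-) + n` for `f : m ⟶ n` in `Δ`. -/
def addNatTrans {m n : Del} (f : m ⟶ n) : addFunctor m ⟶ addFunctor n where
  app k := addHom (𝟙 k) f
  naturality k k' g := by
    change addHom g (𝟙 m) ≫ addHom (𝟙 k') f = addHom (𝟙 k) f ≫ addHom g (𝟙 n)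
    simp [← addHom_comp]

end PiR

/-- The weight `W_r`, the right action of `Δ` on `Π_r` by ordinal sum: it sends the object to
`Π_r`, a `1`-cell `n` to `(-) + n` and a `2`-cell `f` to `(-) + f`.  As
`(-) + (n + m) = ((-) + n) + m`, it is contravariant on `1`-cells. -/
def weightR : StrictPseudofunctor BDelᵒᵖ Cat.{0, 0} :=
  mkCatFunctor (fun _ => PiR) (fun n => PiR.addFunctor n.unop)
    (fun f => PiR.addNatTrans f.unop2)
    (fun n => by
      ext k
      exact PiR.addHom_id k n.unop)
    (fun {_ _ _ _ _} f g => by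
      ext k
      have := PiR.addHom_comp (𝟙 k) (𝟙 k) f.unop2 g.unop2
      rwa [Category.comp_id] at this)
    (fun _ => CategoryTheory.Functor.ext (fun _ => rfl) (fun k k' g => by
      refine (PiR.addHom_zero g).trans ?_
      exact ((Category.id_comp _).trans (Category.comp_id _)).symm))
    (fun m n => CategoryTheory.Functor.ext (fun k => PiR.add_assoc k m.unop n.unop)
      (fun k k' g => by
        have := PiR.addHom_assoc g (𝟙 m.unop) (𝟙 n.unop)
        rwa [Del.sumHom_id] at this))
    (fun m _ _ f k => by
      have := PiR.addHom_assoc (𝟙 k) (𝟙 m.unop) f.unop2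
      rwa [PiR.addHom_id] at this)
    (fun f n k => PiR.addHom_assoc (𝟙 k) f.unop2 (𝟙 n.unop))

end PartialSimplicial

section Monads

/-- A monad `(C, T, η, μ)` in a bicategory. -/
structure Mnd (B : Type u) [Bicategory.{w, v} B] where
  carrier : B
  t : carrier ⟶ carrier
  unit : 𝟙 carrier ⟶ t
  mul : t ≫ t ⟶ t
  unit_mul : unit ▷ t ≫ mul = (λ_ t).hom
  mul_unit : t ◁ unit ≫ mul = (ρ_ t).hom
  mul_mul : mul ▷ t ≫ mul = (α_ t t t).hom ≫ t ◁ mul ≫ mul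

namespace Mnd

variable {B : Type u} [Bicategory.{w, v} B]

/-- A colax morphism of monads `(C, T) ⟶ (C', T')`: a `1`-cell `F : C ⟶ C'` with a `2`-cell
`F T ⟶ T' F` compatible with units and multiplications. -/
structure Hom (S T : Mnd B) where
  map : S.carrier ⟶ T.carrier
  swap : S.t ≫ map ⟶ map ≫ T.t
  unit_swap : S.unit ▷ map ≫ swap = (λ_ map).hom ≫ (ρ_ map).inv ≫ map ◁ T.unit
  mul_swap : S.mul ▷ map ≫ swap =
    (α_ S.t S.t map).hom ≫ S.t ◁ swap ≫ (α_ S.t map T.t).inv ≫ swap ▷ T.t ≫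
      (α_ map T.t T.t).hom ≫ map ◁ T.mul

/-- A transformation of colax morphisms of monads. -/
@[ext]
structure Hom₂ {S T : Mnd B} (F G : Hom S T) where
  cell : F.map ⟶ G.map
  comm : F.swap ≫ cell ▷ T.t = S.t ◁ cell ≫ G.swap

/-- The identity morphism of a monad. -/
def idHom (S : Mnd B) : Hom S S where
  map := 𝟙 S.carrier
  swap := (ρ_ S.t).hom ≫ (λ_ S.t).inv
  unit_swap := by simp
  mul_swap := by simp

/-- Composition of colax morphisms of monads. -/
def compHom {S T U : Mnd B} (F : Hom S T) (G : Hom T U) : Hom S U where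
  map := F.map ≫ G.map
  swap := (α_ S.t F.map G.map).inv ≫ F.swap ▷ G.map ≫ (α_ F.map T.t G.map).hom ≫
    F.map ◁ G.swap ≫ (α_ F.map G.map U.t).inv
  unit_swap := by
    calc
      _ = 𝟙 _ ⊗≫ (S.unit ▷ F.map ≫ F.swap) ▷ G.map ⊗≫ F.map ◁ G.swap ⊗≫ 𝟙 _ := by bicategory
      _ = 𝟙 _ ⊗≫ F.map ◁ (T.unit ▷ G.map ≫ G.swap) ⊗≫ 𝟙 _ := by
        rw [F.unit_swap]; bicategory
      _ = _ := by rw [G.unit_swap]; bicategory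
  mul_swap := by
    calc
      _ = 𝟙 _ ⊗≫ (S.mul ▷ F.map ≫ F.swap) ▷ G.map ⊗≫ F.map ◁ G.swap ⊗≫ 𝟙 _ := by bicategory
      _ = 𝟙 _ ⊗≫ S.t ◁ F.swap ▷ G.map ⊗≫ F.swap ▷ (T.t ≫ G.map) ⊗≫
          F.map ◁ (T.mul ▷ G.map ≫ G.swap) ⊗≫ 𝟙 _ := by
        rw [F.mul_swap]; bicategory
      _ = 𝟙 _ ⊗≫ S.t ◁ F.swap ▷ G.map ⊗≫ (F.swap ▷ (T.t ≫ G.map) ≫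
          (F.map ≫ T.t) ◁ G.swap) ⊗≫ F.map ◁ G.swap ▷ U.t ⊗≫ F.map ◁ G.map ◁ U.mul ⊗≫ 𝟙 _ := by
        rw [G.mul_swap]; bicategory
      _ = _ := by rw [← whisker_exchange]; bicategory

instance homCategory (S T : Mnd B) : Category (Hom S T) where
  Hom F G := Hom₂ F G
  id F := ⟨𝟙 F.map, by simp⟩
  comp σ τ := ⟨σ.cell ≫ τ.cell, by
    rw [comp_whiskerRight, whiskerLeft_comp, Category.assoc, ← τ.comm, reassoc_of% σ.comm]⟩
  id_comp σ := Hom₂.ext (Category.id_comp _)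
  comp_id σ := Hom₂.ext (Category.comp_id _)
  assoc σ τ υ := Hom₂.ext (Category.assoc _ _ _)

@[ext]
theorem hom₂_ext {S T : Mnd B} {F G : Hom S T} {σ τ : F ⟶ G} (h : σ.cell = τ.cell) : σ = τ :=
  Hom₂.ext h

/-- An invertible `2`-cell compatible with the structure is an isomorphism of morphisms. -/
def isoMk {S T : Mnd B} {F G : Hom S T} (e : F.map ≅ G.map)
    (h : F.swap ≫ e.hom ▷ T.t = S.t ◁ e.hom ≫ G.swap) : F ≅ G where
  hom := ⟨e.hom, h⟩
  inv := ⟨e.inv, by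
    rw [← cancel_epi (S.t ◁ e.hom), ← reassoc_of% h]
    simp⟩
  hom_inv_id := Hom₂.ext e.hom_inv_id
  inv_hom_id := Hom₂.ext e.inv_hom_id

/-- Monads in `B`, colax morphisms and their transformations form a bicategory. -/
instance bicategory : Bicategory (Mnd B) where
  Hom := Hom
  id := idHom
  comp := compHom
  homCategory := homCategory
  whiskerLeft {S T U} F G H σ := ⟨F.map ◁ σ.cell, by
    dsimp only [compHom]
    calc
      _ = 𝟙 _ ⊗≫ F.swap ▷ G.map ⊗≫ F.map ◁ (G.swap ≫ σ.cell ▷ U.t) ⊗≫ 𝟙 _ := by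
        bicategory
      _ = 𝟙 _ ⊗≫ (F.swap ▷ G.map ≫ (F.map ≫ T.t) ◁ σ.cell) ⊗≫ F.map ◁ H.swap ⊗≫ 𝟙 _ := by
        rw [σ.comm]; bicategory
      _ = _ := by rw [← whisker_exchange]; bicategory⟩
  whiskerRight {S T U F G} σ H := ⟨σ.cell ▷ H.map, by
    dsimp only [compHom]
    calc
      _ = 𝟙 _ ⊗≫ F.swap ▷ H.map ⊗≫ (F.map ◁ H.swap ≫ σ.cell ▷ (H.map ≫ U.t)) ⊗≫ 𝟙 _ := by
        bicategory
      _ = 𝟙 _ ⊗≫ (F.swap ≫ σ.cell ▷ T.t) ▷ H.map ⊗≫ G.map ◁ H.swap ⊗≫ 𝟙 _ := by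
        rw [whisker_exchange]; bicategory
      _ = _ := by rw [σ.comm]; bicategory⟩
  associator F G H := isoMk (α_ F.map G.map H.map) (by dsimp only [compHom]; bicategory)
  leftUnitor F := isoMk (λ_ F.map) (by dsimp only [compHom, idHom]; bicategory)
  rightUnitor F := isoMk (ρ_ F.map) (by dsimp only [compHom, idHom]; bicategory)
  whiskerLeft_id F G := Hom₂.ext (whiskerLeft_id _ _)
  whiskerLeft_comp F _ _ _ σ τ := Hom₂.ext (whiskerLeft_comp _ _ _)
  id_whiskerLeft σ := Hom₂.ext (id_whiskerLeft _)
  comp_whiskerLeft F G _ _ σ := Hom₂.ext (comp_whiskerLeft _ _ _)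
  id_whiskerRight F G := Hom₂.ext (id_whiskerRight _ _)
  comp_whiskerRight σ τ F := Hom₂.ext (comp_whiskerRight _ _ _)
  whiskerRight_id σ := Hom₂.ext (whiskerRight_id _)
  whiskerRight_comp σ F G := Hom₂.ext (whiskerRight_comp _ _ _)
  whisker_assoc F _ _ σ G := Hom₂.ext (whisker_assoc _ _ _)
  whisker_exchange σ τ := Hom₂.ext (whisker_exchange _ _)
  pentagon F G H K := Hom₂.ext (pentagon _ _ _ _)
  triangle F G := Hom₂.ext (triangle _ _)

theorem hom_ext_of_iso {S T : Mnd B} {F G : S ⟶ T} (e : F ≅ G) (h : F.map = G.map)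
    (he : e.hom.cell = eqToHom h) : F = G := by
  obtain ⟨f, sf, _, _⟩ := F
  obtain ⟨g, sg, _, _⟩ := G
  dsimp at h
  subst h
  have := e.hom.comm
  rw [he] at this
  simp only [eqToHom_refl, id_whiskerRight, whiskerLeft_id, Category.comp_id,
    Category.id_comp] at this
  subst this
  rfl

theorem eqToHom_cell {S T : Mnd B} {F G : S ⟶ T} (h : F = G) :
    Hom₂.cell (eqToHom h) = eqToHom (congrArg Hom.map h) := by
  subst h; rfl

theorem conj_cell {S T : Mnd B} {F F' G G' : S ⟶ T} (h : F = F') (σ : F' ⟶ G') (h' : G' = G) :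
    Hom₂.cell (eqToHom h ≫ σ ≫ eqToHom h') =
      eqToHom (congrArg Hom.map h) ≫ σ.cell ≫ eqToHom (congrArg Hom.map h') := by
  subst h; subst h'
  simp only [eqToHom_refl, Category.id_comp, Category.comp_id]

/-- For a `2`-category `D`, the bicategory `Mnd D` is a `2`-category. -/
instance strict [Bicategory.Strict B] : Bicategory.Strict (Mnd B) where
  id_comp F := hom_ext_of_iso (λ_ F) (Strict.id_comp F.map)
    (congrArg Iso.hom (Strict.leftUnitor_eqToIso F.map))
  comp_id F := hom_ext_of_iso (ρ_ F) (Strict.comp_id F.map)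
    (congrArg Iso.hom (Strict.rightUnitor_eqToIso F.map))
  assoc F G H := hom_ext_of_iso (α_ F G H) (Strict.assoc F.map G.map H.map)
    (congrArg Iso.hom (Strict.associator_eqToIso F.map G.map H.map))
  leftUnitor_eqToIso F := Iso.ext (Hom₂.ext (by
    rw [eqToIso.hom, eqToHom_cell]
    exact congrArg Iso.hom (Strict.leftUnitor_eqToIso F.map)))
  rightUnitor_eqToIso F := Iso.ext (Hom₂.ext (by
    rw [eqToIso.hom, eqToHom_cell]
    exact congrArg Iso.hom (Strict.rightUnitor_eqToIso F.map)))
  associator_eqToIso F G H := Iso.ext (Hom₂.ext (by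
    rw [eqToIso.hom, eqToHom_cell]
    exact congrArg Iso.hom (Strict.associator_eqToIso F.map G.map H.map)))

/-- The identity monad on `X`. -/
abbrev idMonad (X : B) : Mnd B where
  carrier := X
  t := 𝟙 X
  unit := 𝟙 _
  mul := (λ_ (𝟙 X)).hom
  unit_mul := by simp
  mul_unit := by simp [unitors_equal]
  mul_mul := by simp [unitors_equal]

/-- A `1`-cell, as a morphism between identity monads. -/
def idMonadMap {X Y : B} (F : X ⟶ Y) : idMonad X ⟶ idMonad Y where
  map := F
  swap := (λ_ F).hom ≫ (ρ_ F).inv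
  unit_swap := by dsimp only [idMonad]; bicategory
  mul_swap := by dsimp only [idMonad]; bicategory

/-- A `2`-cell, as a transformation between morphisms of identity monads. -/
def idMonadMap₂ {X Y : B} {F G : X ⟶ Y} (σ : F ⟶ G) : idMonadMap F ⟶ idMonadMap G where
  cell := σ
  comm := by dsimp only [idMonad, idMonadMap]; bicategory

theorem incl_map_id (X : B) : idMonadMap (𝟙 X) = 𝟙 (idMonad X) :=
  hom_ext_of_iso (isoMk (F := idMonadMap (𝟙 X)) (G := idHom (idMonad X)) (Iso.refl (𝟙 X))
    (by dsimp only [idMonad, idMonadMap, idHom, Iso.refl]; bicategory)) rfl rfl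

theorem incl_map_comp {X Y Z : B} (F : X ⟶ Y) (G : Y ⟶ Z) :
    idMonadMap (F ≫ G) = idMonadMap F ≫ idMonadMap G :=
  hom_ext_of_iso (isoMk (F := idMonadMap (F ≫ G)) (G := compHom (idMonadMap F) (idMonadMap G))
    (Iso.refl (F ≫ G))
    (by dsimp only [idMonad, idMonadMap, compHom, Iso.refl]; bicategory)) rfl rfl

/-- The embedding `ι : D ⟶ Mnd(D)` sending an object to the identity monad on it. -/
def incl (D : Type u) [Bicategory.{w, v} D] [Bicategory.Strict D] :
    StrictPseudofunctor D (Mnd D) :=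
  StrictPseudofunctor.mk''
    { obj := idMonad
      map := idMonadMap
      map₂ := idMonadMap₂
      map₂_id := fun _ => rfl
      map₂_comp := fun _ _ => rfl
      map_id := fun X => incl_map_id X
      map_comp := fun F G => incl_map_comp F G
      map₂_whisker_left := fun F _ _ σ => Hom₂.ext (by
        refine Eq.trans ?_ (conj_cell _ _ _).symm
        exact ((Category.id_comp _).trans (Category.comp_id _)).symm)
      map₂_whisker_right := fun σ G => Hom₂.ext (by
        refine Eq.trans ?_ (conj_cell _ _ _).symm
        exact ((Category.id_comp _).trans (Category.comp_id _)).symm) }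

end Mnd

end Monads

section Kleisli

/-- A `2`-adjunction `L ⊣ R`: isomorphisms of categories `D(L A, X) ≅ M(A, R X)`, `2`-natural
in `X` and in `A`. -/
structure TwoAdjunction {M : Type u₁} [Bicategory.{w₁, v₁} M] [Bicategory.Strict M]
    {D : Type u} [Bicategory.{w, v} D] [Bicategory.Strict D]
    (L : StrictPseudofunctor M D) (R : StrictPseudofunctor D M) where
  homIso (A : M) : CatNatIso (homFrom (L.obj A)) (R.comp (homFrom A))
  naturality {A A' : M} (f : A ⟶ A') (X : D) :
    precomp X (L.map f) ⋙ (homIso A).app X = (homIso A').app X ⋙ precomp (R.obj X) f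
  naturality₂ {A A' : M} {f g : A ⟶ A'} (η : f ⟶ g) (X : D) (h : L.obj A' ⟶ X) :
    ((homIso A).app X).map (L.map₂ η ▷ h) =
      eqToHom (Functor.congr_obj (naturality f X) h) ≫
        ((precomposing A A' (R.obj X)).map η).app (((homIso A').app X).obj h) ≫
          eqToHom (Functor.congr_obj (naturality g X) h).symm

variable (D : Type u) [Bicategory.{w, v} D] [Bicategory.Strict D]

/-- The `2`-category `D` admits Kleisli objects: the embedding `ι : D ⟶ Mnd(D)` has a left
`2`-adjoint. -/
def AdmitsKleisliObjects : Prop :=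
  ∃ L : StrictPseudofunctor (Mnd D) D, Nonempty (TwoAdjunction L (Mnd.incl D))

variable {D}

/-- The monad `T` admits a Kleisli object: the `2`-functor `Mnd(T, ι(-)) : D ⟶ Cat` is
representable. -/
def HasKleisliObject (T : Mnd D) : Prop :=
  IsRepresentable ((Mnd.incl D).comp (homFrom T))

end Kleisli

end TwoDim

namespace TwoDim

/-! ### Calculus in strict 2-categories up to heterogeneous equality. -/

section Heq

variable {B : Type u} [Bicategory.{w, v} B]

/-! A 2-functor `T` on the simplicial 2-category carries a monad, `monadOf T`, because `1` is a
monoid in `Δ`. The core is `coconeIso`: for each `T`, the cocones weighted by `W_r` with vertex `X`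
are the colax morphisms from `monadOf T` to the identity monad on `X`, 2-naturally in `X`. One of
the two 2-functors is therefore representable exactly when the other is.

To see this, drop the identity from the target: such a colax morphism is a 1-cell `F` with a right
action `FT ⇒ F` satisfying the module laws. On the other side, `Π_r` is the Kleisli category of the
monad `1 + (-)` on `Δ`: a partial map `k → l` with upward closed domain is a total map `k → 1 + l`,
the bottom element standing for "undefined". Hence each of its morphisms factors as a morphism of
`Δ` followed by the nowhere defined map `1 → 0` added to an identity (`PiR.factor`). A cocone is
thus determined by its value `F` at `0` and by the image of `1 → 0`, which is an action (`toAction`,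
`extend_toAction`). Conversely, an action defines a functor on `Π_r` by `g ↦` (image of the total
map, then the action); functoriality is the unit law and the associativity law (`succ_actPow`,
`pred_actPow`).

To pass from all `T` to all monads, each monad has to be `monadOf` of some 2-functor
(`monadOf_toSimplicial`). This uses a normal form: a monotone map is encoded by a unique lattice
path, and a path is interpreted in the iterates of the monad by the unit and by Kleisli extension.
That composition is preserved is then precisely the monad laws in Kleisli form. No uniqueness of the
2-functor is needed.

Finally, `exists_leftAdjoint_iff` identifies a left 2-adjoint of `ι` with Kleisli objects for all
monads, since representing objects assemble into a 2-functor by the Yoneda lemma. -/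

theorem whiskerLeft_heq {a b c : B} {f f' : a ⟶ b} {g h g' h' : b ⟶ c} {σ : g ⟶ h} {σ' : g' ⟶ h'}
    (hf : f = f') (hg : g = g') (hh : h = h') (hσ : σ ≍ σ') : f ◁ σ ≍ f' ◁ σ' := by
  subst hf hg hh hσ; rfl

theorem whiskerRight_heq {a b c : B} {f f' : b ⟶ c} {g h g' h' : a ⟶ b} {σ : g ⟶ h} {σ' : g' ⟶ h'}
    (hf : f = f') (hg : g = g') (hh : h = h') (hσ : σ ≍ σ') : σ ▷ f ≍ σ' ▷ f' := by
  subst hf hg hh hσ; rfl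

theorem functor_map_heq {C : Type u₁} [Category.{v₁} C] {E : Type u₂} [Category.{v₂} E] (F : C ⥤ E)
    {x y x' y' : C} {f : x ⟶ y} {f' : x' ⟶ y'} (hx : x = x') (hy : y = y') (hf : f ≍ f') :
    F.map f ≍ F.map f' := by
  subst hx hy hf; rfl

theorem conj_heq {C : Type u₁} [Category.{v₁} C] {x y x' y' : C} (hx : x = x') (f : x' ⟶ y')
    (hy : y' = y) : eqToHom hx ≫ f ≫ eqToHom hy ≍ f := by
  subst hx hy; simp

/-- The bridge back: strict coherence is stated with conjugation by `eqToHom`, but the calculations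
run with `≍`, where associativity and unit constraints vanish. -/
theorem heq_conj {C : Type u₁} [Category.{v₁} C] {x y x' y' : C} {hx : x = x'} {f : x ⟶ y}
    {f' : x' ⟶ y'} {hy : y' = y} (h : f ≍ f') : f = eqToHom hx ≫ f' ≫ eqToHom hy := by
  subst hx hy h; simp

theorem map₂_whiskerLeft_heq {C : Type u₁} [Bicategory.{w₁, v₁} C] (T : StrictPseudofunctor B C)
    {a b c : B} (f : a ⟶ b) {g h : b ⟶ c} (σ : g ⟶ h) :
    T.map₂ (f ◁ σ) ≍ T.map f ◁ T.map₂ σ := by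
  rw [T.map₂_whisker_left, T.mapComp_eq_eqToIso, T.mapComp_eq_eqToIso, eqToIso.hom, eqToIso.inv]
  exact conj_heq _ _ _

theorem map₂_whiskerRight_heq {C : Type u₁} [Bicategory.{w₁, v₁} C] (T : StrictPseudofunctor B C)
    {a b c : B} {g h : a ⟶ b} (σ : g ⟶ h) (f : b ⟶ c) :
    T.map₂ (σ ▷ f) ≍ T.map₂ σ ▷ T.map f := by
  rw [T.map₂_whisker_right, T.mapComp_eq_eqToIso, T.mapComp_eq_eqToIso, eqToIso.hom, eqToIso.inv]
  exact conj_heq _ _ _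

variable [Bicategory.Strict B]

theorem id_whiskerLeft_heq {a b : B} {f g : a ⟶ b} (σ : f ⟶ g) : 𝟙 a ◁ σ ≍ σ := by
  rw [id_whiskerLeft, Strict.leftUnitor_eqToIso, Strict.leftUnitor_eqToIso, eqToIso.hom,
    eqToIso.inv]
  exact conj_heq _ _ _

theorem whiskerRight_id_heq {a b : B} {f g : a ⟶ b} (σ : f ⟶ g) : σ ▷ 𝟙 b ≍ σ := by
  rw [whiskerRight_id_conj]
  exact conj_heq _ _ _

theorem whiskerRight_comp_heq {a b c d : B} {p q : a ⟶ b} (σ : p ⟶ q) (f : b ⟶ c) (g : c ⟶ d) :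
    σ ▷ (f ≫ g) ≍ σ ▷ f ▷ g := by
  rw [whiskerRight_comp_conj]
  exact conj_heq _ _ _

theorem whisker_assoc_heq {a b c d : B} (p : a ⟶ b) {f f' : b ⟶ c} (σ : f ⟶ f') (g : c ⟶ d) :
    (p ◁ σ) ▷ g ≍ p ◁ σ ▷ g := by
  rw [whisker_assoc_conj']
  exact conj_heq _ _ _

theorem comp_whiskerLeft_heq {a b c d : B} (p : a ⟶ b) (f : b ⟶ c) {g g' : c ⟶ d} (σ : g ⟶ g') :
    (p ≫ f) ◁ σ ≍ p ◁ f ◁ σ := by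
  rw [whiskerLeft_comp_conj]
  exact (conj_heq _ _ _).symm

theorem leftUnitor_hom_heq {a b : B} (f : a ⟶ b) : (λ_ f).hom ≍ 𝟙 f := by
  rw [Strict.leftUnitor_eqToIso, eqToIso.hom]
  exact eqToHom_heq_id_cod _ _ _

theorem associator_hom_comp_heq {a b c d : B} (f : a ⟶ b) (g : b ⟶ c) (h : c ⟶ d) {k : a ⟶ d}
    (σ : f ≫ g ≫ h ⟶ k) : (α_ f g h).hom ≫ σ ≍ σ := by
  rw [Strict.associator_eqToIso, eqToIso.hom]
  exact eqToHom_comp_heq _ _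

theorem associator_inv_comp_heq {a b c d : B} (f : a ⟶ b) (g : b ⟶ c) (h : c ⟶ d) {k : a ⟶ d}
    (σ : (f ≫ g) ≫ h ⟶ k) : (α_ f g h).inv ≫ σ ≍ σ := by
  rw [Strict.associator_eqToIso, eqToIso.inv]
  exact eqToHom_comp_heq _ _

end Heq

section CatNat

variable {B : Type u} [Bicategory.{w, v} B] {F : StrictPseudofunctor B Cat.{v₁, u₁}}
  {G : StrictPseudofunctor B Cat.{v₂, u₂}}

theorem CatNat.naturality₂_heq (α : CatNat F G) {X Y : B} {f g : X ⟶ Y} (η : f ⟶ g)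
    (x : F.obj X) : (α.app Y).map ((F.map₂ η).toNatTrans.app x) ≍
      (G.map₂ η).toNatTrans.app ((α.app X).obj x) := by
  rw [α.naturality₂]
  exact conj_heq _ _ _

end CatNat

/-! ### Left 2-adjoints from pointwise representability. -/

section Adjoint

variable {M : Type u₁} [Bicategory.{w₁, v₁} M] [Bicategory.Strict M]
    {D : Type u} [Bicategory.{w, v} D] [Bicategory.Strict D]
    (R : StrictPseudofunctor D M)

/-- A representation of `M(A, R(-))`: isomorphisms of categories `D(K, X) ≅ M(A, R X)`, natural
in `X`. -/
structure UniversalArrow (A : M) (K : D) where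
  hom (X : D) : (K ⟶ X) ⥤ (A ⟶ R.obj X)
  inv (X : D) : (A ⟶ R.obj X) ⥤ (K ⟶ X)
  hom_inv (X : D) : hom X ⋙ inv X = 𝟭 _
  inv_hom (X : D) : inv X ⋙ hom X = 𝟭 _
  obj_comp {X Y : D} (h : K ⟶ X) (k : X ⟶ Y) : (hom Y).obj (h ≫ k) = (hom X).obj h ≫ R.map k
  map_whiskerRight {X Y : D} {h h' : K ⟶ X} (σ : h ⟶ h') (k : X ⟶ Y) :
    (hom Y).map (σ ▷ k) ≍ (hom X).map σ ▷ R.map k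
  map_whiskerLeft {X Y : D} (h : K ⟶ X) {k k' : X ⟶ Y} (τ : k ⟶ k') :
    (hom Y).map (h ◁ τ) ≍ (hom X).obj h ◁ R.map₂ τ

variable {R}

def UniversalArrow.ofIso {A : M} {K : D} (ρ : CatNatIso (homFrom K) (R.comp (homFrom A))) :
    UniversalArrow R A K where
  hom X := ρ.app X
  inv X := ρ.inv X
  hom_inv X := ρ.app_inv X
  inv_hom X := ρ.inv_app X
  obj_comp h k := Functor.congr_obj (ρ.naturality k) h
  map_whiskerRight σ k := Functor.hcongr_hom (ρ.naturality k) σ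
  map_whiskerLeft h _ _ τ := ρ.toCatNat.naturality₂_heq τ h

namespace UniversalArrow

variable {A A' A'' : M} {K K' K'' : D} (ρ : UniversalArrow R A K) (ρ' : UniversalArrow R A' K')
  (ρ'' : UniversalArrow R A'' K'')

theorem obj_inj {X : D} {h h' : K ⟶ X} (H : (ρ.hom X).obj h = (ρ.hom X).obj h') : h = h' :=
  (Functor.congr_obj (ρ.hom_inv X) h).symm.trans <|
    (congrArg (ρ.inv X).obj H).trans (Functor.congr_obj (ρ.hom_inv X) h')

theorem obj_inv_obj {X : D} (h : A ⟶ R.obj X) : (ρ.hom X).obj ((ρ.inv X).obj h) = h :=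
  Functor.congr_obj (ρ.inv_hom X) h

theorem map_inv_map {X : D} {h h' : A ⟶ R.obj X} (σ : h ⟶ h') :
    (ρ.hom X).map ((ρ.inv X).map σ) ≍ σ :=
  Functor.hcongr_hom (ρ.inv_hom X) σ

theorem inv_map_map {X : D} {h h' : K ⟶ X} (σ : h ⟶ h') :
    (ρ.inv X).map ((ρ.hom X).map σ) ≍ σ :=
  Functor.hcongr_hom (ρ.hom_inv X) σ

/-- Together with `obj_inj`, this lets every law for induced cells be tested after transport along
the isomorphism of categories, where it becomes a law in `M`. -/
theorem map_inj {X : D} {h h' k k' : K ⟶ X} {σ : h ⟶ h'} {τ : k ⟶ k'} (hh : h = k) (hk : h' = k')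
    (H : (ρ.hom X).map σ ≍ (ρ.hom X).map τ) : σ ≍ τ := by
  subst hh hk
  exact (ρ.inv_map_map σ).symm.trans ((heq_of_eq (congrArg (ρ.inv X).map (eq_of_heq H))).trans
    (ρ.inv_map_map τ))

/-- The universal `1`-cell. -/
def unit : A ⟶ R.obj K := (ρ.hom K).obj (𝟙 K)

/-- The Yoneda lemma: naturality applied to `𝟙 K` shows that the isomorphism is composition with the
universal 1-cell. `hom_map` is the same for 2-cells. -/
theorem hom_obj {X : D} (h : K ⟶ X) : (ρ.hom X).obj h = ρ.unit ≫ R.map h := by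
  rw [unit, ← ρ.obj_comp, Strict.id_comp]

theorem hom_map {X : D} {h h' : K ⟶ X} (σ : h ⟶ h') : (ρ.hom X).map σ ≍ ρ.unit ◁ R.map₂ σ :=
  (functor_map_heq _ (Strict.id_comp h).symm (Strict.id_comp h').symm
    (id_whiskerLeft_heq σ).symm).trans (ρ.map_whiskerLeft (𝟙 K) σ)

/-- The `1`-cell induced on representing objects. -/
def lift (f : A ⟶ A') : K ⟶ K' := (ρ.inv K').obj (f ≫ ρ'.unit)

/-- The `2`-cell induced on representing objects. -/
def lift₂ {f g : A ⟶ A'} (η : f ⟶ g) : ρ.lift ρ' f ⟶ ρ.lift ρ' g := (ρ.inv K').map (η ▷ ρ'.unit)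

theorem hom_lift (f : A ⟶ A') : (ρ.hom K').obj (ρ.lift ρ' f) = f ≫ ρ'.unit := ρ.obj_inv_obj _

theorem hom_lift₂ {f g : A ⟶ A'} (η : f ⟶ g) :
    (ρ.hom K').map (ρ.lift₂ ρ' η) ≍ η ▷ ρ'.unit := ρ.map_inv_map _

/-- Used twice: it gives functoriality of `lift`, and it is the naturality of the adjunction in `A`.
-/
theorem hom_lift_comp (f : A ⟶ A') {X : D} (h : K' ⟶ X) :
    (ρ.hom X).obj (ρ.lift ρ' f ≫ h) = f ≫ (ρ'.hom X).obj h := by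
  rw [ρ.obj_comp, hom_lift, ρ'.hom_obj, Strict.assoc]

theorem hom_lift_whiskerLeft (f : A ⟶ A') {X : D} {h h' : K' ⟶ X} (σ : h ⟶ h') :
    (ρ.hom X).map (ρ.lift ρ' f ◁ σ) ≍ f ◁ (ρ'.hom X).map σ :=
  (ρ.map_whiskerLeft _ σ).trans <|
    (whiskerLeft_heq (ρ.hom_lift ρ' f) rfl rfl HEq.rfl).trans <|
      (comp_whiskerLeft_heq _ _ _).trans <|
        whiskerLeft_heq rfl (ρ'.hom_obj h).symm (ρ'.hom_obj h').symm (ρ'.hom_map σ).symm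

theorem hom_lift₂_whiskerRight {f g : A ⟶ A'} (η : f ⟶ g) {X : D} (h : K' ⟶ X) :
    (ρ.hom X).map (ρ.lift₂ ρ' η ▷ h) ≍ η ▷ (ρ'.hom X).obj h :=
  (ρ.map_whiskerRight _ h).trans <|
    (whiskerRight_heq rfl (ρ.hom_lift ρ' f) (ρ.hom_lift ρ' g) (ρ.hom_lift₂ ρ' η)).trans <|
      (whiskerRight_comp_heq _ _ _).symm.trans <|
        whiskerRight_heq (ρ'.hom_obj h).symm rfl rfl HEq.rfl

theorem lift_id : ρ.lift ρ (𝟙 A) = 𝟙 K :=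
  ρ.obj_inj ((ρ.hom_lift ρ _).trans (Strict.id_comp _))

theorem lift_comp (f : A ⟶ A') (g : A' ⟶ A'') :
    ρ.lift ρ'' (f ≫ g) = ρ.lift ρ' f ≫ ρ'.lift ρ'' g :=
  ρ.obj_inj (by rw [hom_lift, hom_lift_comp, hom_lift, Strict.assoc])

theorem lift₂_id (f : A ⟶ A') : ρ.lift₂ ρ' (𝟙 f) = 𝟙 _ :=
  (congrArg (ρ.inv K').map (id_whiskerRight f ρ'.unit)).trans ((ρ.inv K').map_id _)

theorem lift₂_comp {f g h : A ⟶ A'} (η : f ⟶ g) (θ : g ⟶ h) :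
    ρ.lift₂ ρ' (η ≫ θ) = ρ.lift₂ ρ' η ≫ ρ.lift₂ ρ' θ :=
  (congrArg (ρ.inv K').map (comp_whiskerRight η θ ρ'.unit)).trans ((ρ.inv K').map_comp _ _)

theorem lift₂_whiskerLeft (f : A ⟶ A') {g g' : A' ⟶ A''} (η : g ⟶ g') :
    ρ.lift₂ ρ'' (f ◁ η) ≍ ρ.lift ρ' f ◁ ρ'.lift₂ ρ'' η :=
  ρ.map_inj (ρ.lift_comp ρ' ρ'' f g) (ρ.lift_comp ρ' ρ'' f g') <|
    (ρ.hom_lift₂ ρ'' _).trans <| (whisker_assoc_heq _ _ _).trans <|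
      (whiskerLeft_heq rfl (ρ'.hom_lift ρ'' g).symm (ρ'.hom_lift ρ'' g').symm
        (ρ'.hom_lift₂ ρ'' η).symm).trans (ρ.hom_lift_whiskerLeft ρ' f _).symm

theorem lift₂_whiskerRight {f f' : A ⟶ A'} (η : f ⟶ f') (g : A' ⟶ A'') :
    ρ.lift₂ ρ'' (η ▷ g) ≍ ρ.lift₂ ρ' η ▷ ρ'.lift ρ'' g :=
  ρ.map_inj (ρ.lift_comp ρ' ρ'' f g) (ρ.lift_comp ρ' ρ'' f' g) <|
    (ρ.hom_lift₂ ρ'' _).trans <| (whiskerRight_comp_heq _ _ _).symm.trans <|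
      (whiskerRight_heq (ρ'.hom_lift ρ'' g).symm rfl rfl HEq.rfl).trans
        (ρ.hom_lift₂_whiskerRight ρ' η _).symm

/-- The left `2`-adjoint assembled from universal arrows. -/
def leftAdjoint {K : M → D} (ρ : ∀ A, UniversalArrow R A (K A)) : StrictPseudofunctor M D :=
  StrictPseudofunctor.mk''
    { obj := K
      map := fun {A A'} f => (ρ A).lift (ρ A') f
      map₂ := fun {A A'} _ _ η => (ρ A).lift₂ (ρ A') η
      map₂_id := fun {A A'} f => (ρ A).lift₂_id (ρ A') f
      map₂_comp := fun {A A'} _ _ _ η θ => (ρ A).lift₂_comp (ρ A') η θ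
      map_id := fun A => (ρ A).lift_id
      map_comp := fun f g => (ρ _).lift_comp (ρ _) (ρ _) f g
      map₂_whisker_left := fun f _ _ η => heq_conj ((ρ _).lift₂_whiskerLeft (ρ _) (ρ _) f η)
      map₂_whisker_right := fun η g => heq_conj ((ρ _).lift₂_whiskerRight (ρ _) (ρ _) η g) }

end UniversalArrow

/-- A `2`-functor has a left `2`-adjoint if and only if all `M(A, R(-))` are representable. -/
theorem exists_leftAdjoint_iff (R : StrictPseudofunctor D M) :
    (∃ L : StrictPseudofunctor M D, Nonempty (TwoAdjunction L R)) ↔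
      ∀ A : M, IsRepresentable (R.comp (homFrom A)) := by
  constructor
  · rintro ⟨L, ⟨h⟩⟩ A
    exact ⟨L.obj A, ⟨h.homIso A⟩⟩
  · intro h
    choose K hK using h
    let e := fun A => (hK A).some
    let ρ := fun A => UniversalArrow.ofIso (e A)
    refine ⟨UniversalArrow.leftAdjoint ρ, ⟨⟨e, ?_, ?_⟩⟩⟩
    -- Naturality in `A` is built into the definition of `lift`, so the chosen isomorphisms already
    -- form the adjunction.
    · intro A A' f X
      exact Functor.hext (fun h => (ρ A).hom_lift_comp (ρ A') f h)
        (fun _ _ σ => (ρ A).hom_lift_whiskerLeft (ρ A') f σ)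
    · intro A A' f g η X h
      exact heq_conj ((ρ A).hom_lift₂_whiskerRight (ρ A') η h)

end Adjoint

/-! ### Isomorphisms of Cat-valued 2-functors and transport of representability. -/

section CatNatIso

variable {B : Type u} [Bicategory.{w, v} B] {F : StrictPseudofunctor B Cat.{v₁, u₁}}
  {G : StrictPseudofunctor B Cat.{v₂, u₂}}

/-- The inverse of an isomorphism of `2`-functors. -/
def CatNatIso.symm (α : CatNatIso F G) : CatNatIso G F where
  app := α.inv
  inv := α.app
  app_inv := α.inv_app
  inv_app := α.app_inv
  naturality {X Y} f := by
    have h := congrArg (fun H => α.inv X ⋙ H ⋙ α.inv Y) (α.naturality f)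
    rw [Functor.assoc, α.app_inv, Functor.comp_id, ← Functor.assoc, ← Functor.assoc, α.inv_app,
      Functor.id_comp] at h
    exact h.symm
  naturality₂ {X Y f g} η x := heq_conj (by
    have h₁ := α.toCatNat.naturality₂_heq η ((α.inv X).obj x)
    have e : (α.app X).obj ((α.inv X).obj x) = x := Functor.congr_obj (α.inv_app X) x
    have h₂ : (G.map₂ η).toNatTrans.app ((α.app X).obj ((α.inv X).obj x)) ≍
        (G.map₂ η).toNatTrans.app x := by rw [e]
    have k : ∀ y, (α.app Y).obj ((F.map y).toFunctor.obj ((α.inv X).obj x)) =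
        (G.map y).toFunctor.obj x := fun y => (Functor.congr_obj (α.naturality y) _).trans (by
      rw [Functor.comp_obj, e])
    -- The naturality square of `α` at the preimage of `x` is carried back by the inverse functor,
    -- which cancels the component of `α` on the left.
    refine (functor_map_heq (α.inv Y) (k f).symm (k g).symm (h₁.trans h₂).symm).trans ?_
    exact Functor.hcongr_hom (α.app_inv Y) _)

universe v₃ u₃

/-- The composite of isomorphisms of `2`-functors. -/
def CatNatIso.trans {H : StrictPseudofunctor B Cat.{v₃, u₃}} (α : CatNatIso F G)
    (β : CatNatIso G H) : CatNatIso F H where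
  app X := α.app X ⋙ β.app X
  inv X := β.inv X ⋙ α.inv X
  app_inv X := by
    rw [Functor.assoc, ← Functor.assoc (β.app X), β.app_inv, Functor.id_comp, α.app_inv]
  inv_app X := by
    rw [Functor.assoc, ← Functor.assoc (α.inv X), α.inv_app, Functor.id_comp, β.inv_app]
  naturality {X Y} f := by
    rw [← Functor.assoc, α.naturality, Functor.assoc, β.naturality, Functor.assoc]
  naturality₂ {X Y f g} η x := heq_conj <|
    (functor_map_heq (β.app Y) (Functor.congr_obj (α.naturality f) x)
      (Functor.congr_obj (α.naturality g) x) (α.toCatNat.naturality₂_heq η x)).trans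
        (β.toCatNat.naturality₂_heq η _)

theorem IsRepresentable.of_iso [Bicategory.Strict B] (h : IsRepresentable F) (e : CatNatIso F G) :
    IsRepresentable G :=
  h.imp fun _ ⟨ρ⟩ => ⟨ρ.trans e⟩

end CatNatIso

/-! ### The monoid `1` in `Δ` and the monad `1 + (-)`. -/

namespace Del

theorem hom_heq {m n m' n' : Del} (hm : m = m') (hn : n = n') {f : m ⟶ n} {g : m' ⟶ n'}
    (h : ∀ i hi hi', (f.toFun ⟨i, hi⟩).val = (g.toFun ⟨i, hi'⟩).val) : f ≍ g := by
  subst hm hn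
  exact heq_of_eq (hom_ext fun i => h i.val i.isLt i.isLt)

/-- The map to the terminal ordinal. -/
def bang (n : Del) : n ⟶ (⟨1⟩ : Del) := ⟨fun _ => 0, fun _ _ _ => le_rfl⟩

/-- Terminality of `1` is the source of its monoid structure: every monoid law compares two maps
into `1`. -/
theorem hom_one_ext {n : Del} (f g : n ⟶ (⟨1⟩ : Del)) : f = g :=
  hom_ext fun i => by have := (f.toFun i).isLt; have := (g.toFun i).isLt; dsimp at *; omega

/-- The inclusion `n ⟶ 1 + n`. -/
def succ (n : Del) : n ⟶ sum ⟨1⟩ n where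
  toFun i := ⟨1 + i.val, Nat.add_lt_add_left i.isLt 1⟩
  mono _ _ h := Nat.add_le_add_left h 1

/-- The multiplication `1 + (1 + n) ⟶ 1 + n` of the monad `1 + (-)` on `Δ`. -/
def pred (n : Del) : sum ⟨1⟩ (sum ⟨1⟩ n) ⟶ sum ⟨1⟩ n where
  toFun i := ⟨i.val - 1, by have := i.isLt; simp at this ⊢; omega⟩
  mono _ _ h := Nat.sub_le_sub_right h 1

/-- With `pred_heq`, this exhibits the unit and multiplication of `1 + (-)` at `n` as those of the
monoid `1` padded by `n`, so a 2-functor sends them to whiskered unit and multiplication cells. -/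
theorem succ_heq (n : Del) : succ n ≍ sumHom (bang ⟨0⟩) (𝟙 n) :=
  hom_heq (zero_sum n).symm rfl fun i _ hi' =>
    (sumHom_ge (bang ⟨0⟩) (𝟙 n) hi' (Nat.zero_le i) (by simpa using hi')).symm

theorem pred_heq (n : Del) : pred n ≍ sumHom (bang (sum ⟨1⟩ ⟨1⟩)) (𝟙 n) := by
  refine hom_heq (sum_assoc ⟨1⟩ ⟨1⟩ n).symm rfl fun i hi hi' => ?_
  have h : i < 1 + (1 + n.card) := hi
  refine Eq.trans ?_ (sumHom_val _ _ _).symm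
  split_ifs with h₁
  · have : i < 2 := h₁
    change i - 1 = 0
    omega
  · have : ¬ i < 2 := h₁
    change i - 1 = 1 + (i - 2)
    omega

end Del

/-! ### `Π_r` as the Kleisli category of `1 + (-)`. -/

namespace PiR

/-- A morphism `k ⟶ l` of `Π_r` as a total map `k ⟶ 1 + l`. -/
def toDel {k l : PiR} (g : k ⟶ l) : (⟨k.card⟩ : Del) ⟶ Del.sum ⟨1⟩ ⟨l.card⟩ where
  toFun i := (g.toFun i).elim ⟨0, by simp⟩ fun a => ⟨1 + a.val, Nat.add_lt_add_left a.isLt 1⟩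
  mono i j h := by
    dsimp only
    cases hi : g.toFun i with
    | none => exact Nat.zero_le _
    | some a =>
      -- Upward closure of the domain is what gives monotonicity: the undefined points form an
      -- initial segment and go to the bottom element.
      obtain ⟨b, hb⟩ := Option.isSome_iff_exists.1 (g.upper h (by simp [hi]))
      rw [hb]
      exact Nat.add_le_add_left (g.mono h hi hb) 1

theorem toDel_val {k l : PiR} (g : k ⟶ l) (i : Fin k.card) :
    ((toDel g).toFun i).val = (g.toFun i).elim 0 fun a => 1 + a.val := by
  unfold toDel
  dsimp only
  cases g.toFun i <;> rfl

/-- This is Kleisli composition. The two ways of being undefined, at the first map or at the second,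
are the points `0` and `1` of `1 + (1 + m)`, and `pred` merges them. -/
theorem toDel_comp {k l m : PiR} (g : k ⟶ l) (h : l ⟶ m) :
    toDel (g ≫ h) = toDel g ≫ Del.sumHom (𝟙 (⟨1⟩ : Del)) (toDel h) ≫ Del.pred ⟨m.card⟩ := by
  apply Del.hom_ext
  intro i
  rw [toDel_val, comp_toFun, Del.comp_toFun, Del.comp_toFun]
  change _ = ((Del.sumHom (𝟙 (⟨1⟩ : Del)) (toDel h)).toFun ((toDel g).toFun i)).val - 1
  rw [Del.sumHom_val]
  cases hi : g.toFun i with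
  | none =>
    have : ((toDel g).toFun i).val = 0 := by rw [toDel_val, hi]; rfl
    rw [dif_pos (by rw [this]; exact Nat.one_pos)]
    simp [this]
  | some a =>
    have : ((toDel g).toFun i).val = 1 + a.val := by rw [toDel_val, hi]; rfl
    rw [dif_neg (by rw [this]; dsimp; omega)]
    simp only [this, Nat.add_sub_cancel_left]
    exact (toDel_val h a).symm

theorem toDel_addHom {k l : PiR} {m n : Del} (g : k ⟶ l) (f : m ⟶ n) :
    toDel (addHom g f) ≍ Del.sumHom (toDel g) f := by
  refine Del.hom_heq rfl (Del.sum_assoc ⟨1⟩ ⟨l.card⟩ n).symm fun i hi hi' => ?_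
  have hi'' : i < k.card + m.card := hi
  refine (toDel_val _ _).trans ?_
  by_cases h : i < k.card
  · refine Eq.trans ?_ ((Del.sumHom_lt (toDel g) f hi' h).trans (toDel_val _ _)).symm
    rw [addHom_lt _ _ _ h]
    cases g.toFun ⟨i, h⟩ <;> rfl
  · refine Eq.trans ?_ (Del.sumHom_ge (toDel g) f hi' (show k.card ≤ i by omega)
      (show i - k.card < m.card by omega)).symm
    rw [addHom_ge _ _ _ (by omega) (by omega)]
    exact (Nat.add_assoc _ _ _).symm

/-- The sum is everywhere defined, so its Kleisli form misses the bottom element and factors through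
the unit `succ`. -/
theorem toDel_id_addHom (k : PiR) {m n : Del} (f : m ⟶ n) :
    toDel (addHom (𝟙 k) f) = Del.sumHom (𝟙 (⟨k.card⟩ : Del)) f ≫ Del.succ (Del.sum ⟨k.card⟩ n) := by
  apply Del.hom_ext
  rintro ⟨i, hi⟩
  have hi'' : i < k.card + m.card := hi
  refine (toDel_val _ _).trans ?_
  change _ = 1 + ((Del.sumHom (𝟙 (⟨k.card⟩ : Del)) f).toFun ⟨i, hi⟩).val
  by_cases h : i < k.card
  · refine Eq.trans ?_ (congrArg (1 + ·) (Del.sumHom_lt (𝟙 (⟨k.card⟩ : Del)) f hi h)).symm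
    rw [addHom_lt _ _ _ h, id_toFun]
    rfl
  · refine Eq.trans ?_ (congrArg (1 + ·) (Del.sumHom_ge (𝟙 (⟨k.card⟩ : Del)) f hi
      (show k.card ≤ i by omega) (show i - k.card < m.card by omega))).symm
    rw [addHom_ge _ _ _ (by omega) (by omega)]
    rfl

/-- The nowhere defined map. -/
def undef (k l : PiR) : k ⟶ l :=
  ⟨fun _ => none, fun _ _ _ _ _ h => (Option.some_ne_none _ h.symm).elim, fun _ _ _ h => h⟩

/-- Terminality of `0` in `Π_r` plays for modules the role that terminality of `1` in `Δ` plays for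
monoids: both module laws compare maps into `0`. -/
theorem hom_zero_ext {k : PiR} (f g : k ⟶ (⟨0⟩ : PiR)) : f = g :=
  Hom.ext (funext fun i => by
    cases f.toFun i with
    | some a => exact a.elim0
    | none => cases g.toFun i with
      | some a => exact a.elim0
      | none => rfl)

theorem zero_add (k : PiR) : add ⟨0⟩ ⟨k.card⟩ = k := PiR.ext (Nat.zero_add _)

theorem hom_heq {m n m' n' : PiR} (hm : m = m') (hn : n = n') {f : m ⟶ n} {g : m' ⟶ n'}
    (h : ∀ i hi hi', (f.toFun ⟨i, hi⟩).map Fin.val = (g.toFun ⟨i, hi'⟩).map Fin.val) : f ≍ g := by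
  subst hm hn
  exact heq_of_eq (hom_ext fun i hi =>
    Option.map_injective Fin.val_injective (h i hi hi))

/-- Every morphism of `Π_r` is a total map followed by one undefined on a point. -/
theorem factor {k l : PiR} (g : k ⟶ l) :
    addHom (𝟙 ⟨0⟩) (toDel g) ≫ eqToHom (add_assoc ⟨0⟩ ⟨1⟩ ⟨l.card⟩) ≫
      addHom (undef (add ⟨0⟩ ⟨1⟩) ⟨0⟩) (𝟙 (⟨l.card⟩ : Del)) ≍ g := by
  refine hom_heq (zero_add k) (zero_add l) fun i hi hi' => ?_
  -- The total map lands in `1 + l`; the second factor is undefined on its bottom point, which is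
  -- hit exactly where `g` is undefined, and removes the shift by one elsewhere.
  rw [comp_toFun, addHom_ge _ _ _ (Nat.zero_le _) hi', Option.bind_some, comp_toFun,
    eqToHom_toFun, Option.bind_some]
  have h₁ := toDel_val g ⟨i, hi'⟩
  cases h : g.toFun ⟨i, hi'⟩ with
  | none =>
    rw [h] at h₁
    have h₂ : 0 + ((toDel g).toFun ⟨i, hi'⟩).val < 0 + 1 := by rw [h₁]; exact Nat.one_pos
    exact congrArg (Option.map Fin.val) (addHom_lt _ _ _ h₂)
  | some a =>
    rw [h] at h₁
    have h₂ : 0 + 1 ≤ 0 + ((toDel g).toFun ⟨i, hi'⟩).val := by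
      rw [h₁]; exact Nat.add_le_add_left (Nat.le_add_right _ _) _
    have h₃ : 0 + ((toDel g).toFun ⟨i, hi'⟩).val - (0 + 1) = a.val := by
      rw [h₁]; simp
    refine (congrArg (Option.map Fin.val) (addHom_ge _ _ _ h₂ (h₃.trans_lt a.isLt))).trans ?_
    exact congrArg some ((Nat.zero_add _).trans h₃)

end PiR

/-! ### The monad carried by a 2-functor on the simplicial 2-category. -/

section CellPowers

variable {D : Type u} [Bicategory.{w, v} D] (T : StrictPseudofunctor BDel D)

/-- The image of the `1`-cell `n` under a `2`-functor on the simplicial `2`-category. -/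
def pow (n : Del) : T.obj .star ⟶ T.obj .star :=
  T.map (show BDel.star ⟶ BDel.star from n)

/-- The image of a `2`-cell under a `2`-functor on the simplicial `2`-category. -/
def powMap {m n : Del} (f : m ⟶ n) : pow T m ⟶ pow T n :=
  T.map₂ (a := .star) (b := .star) (f := m) (g := n) f

theorem pow_zero : pow T ⟨0⟩ = 𝟙 _ := T.map_id .star

theorem pow_sum (m n : Del) : pow T (Del.sum m n) = pow T n ≫ pow T m :=
  T.map_comp (show BDel.star ⟶ BDel.star from n) (show BDel.star ⟶ BDel.star from m)

theorem powMap_id (n : Del) : powMap T (𝟙 n) = 𝟙 _ := T.map₂_id (a := .star) (b := .star) n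

theorem powMap_comp {k m n : Del} (f : k ⟶ m) (g : m ⟶ n) :
    powMap T (f ≫ g) = powMap T f ≫ powMap T g :=
  T.map₂_comp (a := .star) (b := .star) (f := k) (g := m) (h := n) f g

theorem powMap_heq {m n m' n' : Del} {f : m ⟶ n} {g : m' ⟶ n'} (hm : m = m') (hn : n = n')
    (h : f ≍ g) : powMap T f ≍ powMap T g := by
  subst hm hn h; rfl

theorem powMap_sumHom_id {m n : Del} (f : m ⟶ n) (k : Del) :
    powMap T (Del.sumHom f (𝟙 k)) ≍ pow T k ◁ powMap T f :=
  map₂_whiskerLeft_heq T (a := .star) (b := .star) (c := .star) k (g := m) (h := n) f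

theorem powMap_id_sumHom {m n : Del} (f : m ⟶ n) (k : Del) :
    powMap T (Del.sumHom (𝟙 k) f) ≍ powMap T f ▷ pow T k :=
  map₂_whiskerRight_heq T (a := .star) (b := .star) (c := .star) (g := m) (h := n) f k

variable [Bicategory.Strict D]

/-- The monad given by a `2`-functor on the simplicial `2`-category. -/
def monadOf : Mnd D where
  carrier := T.obj .star
  t := pow T ⟨1⟩
  unit := eqToHom (pow_zero T).symm ≫ powMap T (Del.bang ⟨0⟩)
  mul := eqToHom (pow_sum T ⟨1⟩ ⟨1⟩).symm ≫ powMap T (Del.bang (Del.sum ⟨1⟩ ⟨1⟩))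
  unit_mul := by
    have h₁ : (eqToHom (pow_zero T).symm ≫ powMap T (Del.bang ⟨0⟩)) ▷ pow T ⟨1⟩ ≍
        powMap T (Del.sumHom (𝟙 ⟨1⟩) (Del.bang ⟨0⟩)) :=
      (whiskerRight_heq rfl (pow_zero T).symm rfl (eqToHom_comp_heq _ _)).trans
        (powMap_id_sumHom T _ _).symm
    have h₂ := heq_comp ((congrArg (· ≫ pow T ⟨1⟩) (pow_zero T).symm).trans
      (pow_sum T ⟨1⟩ ⟨0⟩).symm) (pow_sum T ⟨1⟩ ⟨1⟩).symm rfl h₁ (eqToHom_comp_heq (powMap T (Del.bang (Del.sum ⟨1⟩ ⟨1⟩)))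
        (pow_sum T ⟨1⟩ ⟨1⟩).symm)
    -- Up to `≍` the composite is the image of one map of `Δ` into `1`, hence of the unique such
    -- map. The other two laws are proved in the same way.
    rw [← powMap_comp, Del.hom_one_ext (_ ≫ _) (Del.bang _)] at h₂
    have h₃ : powMap T (Del.bang (Del.sum ⟨1⟩ ⟨0⟩)) ≍ 𝟙 (pow T ⟨1⟩) := by
      rw [← powMap_id]
      exact heq_of_eq (congrArg (powMap T) (Del.hom_one_ext _ _))
    rw [Strict.leftUnitor_eqToIso, eqToIso.hom]
    exact eq_of_heq (h₂.trans (h₃.trans (eqToHom_heq_id_cod _ _ _).symm))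
  mul_unit := by
    have h₁ : pow T ⟨1⟩ ◁ (eqToHom (pow_zero T).symm ≫ powMap T (Del.bang ⟨0⟩)) ≍
        powMap T (Del.sumHom (Del.bang ⟨0⟩) (𝟙 ⟨1⟩)) :=
      (whiskerLeft_heq rfl (pow_zero T).symm rfl (eqToHom_comp_heq _ _)).trans
        (powMap_sumHom_id T _ _).symm
    have h₂ := heq_comp ((congrArg (pow T ⟨1⟩ ≫ ·) (pow_zero T).symm).trans
      (pow_sum T ⟨0⟩ ⟨1⟩).symm) (pow_sum T ⟨1⟩ ⟨1⟩).symm rfl h₁ (eqToHom_comp_heq (powMap T (Del.bang (Del.sum ⟨1⟩ ⟨1⟩)))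
        (pow_sum T ⟨1⟩ ⟨1⟩).symm)
    rw [← powMap_comp, Del.hom_one_ext (_ ≫ _) (Del.bang _)] at h₂
    have h₃ : powMap T (Del.bang (Del.sum ⟨0⟩ ⟨1⟩)) ≍ 𝟙 (pow T ⟨1⟩) := by
      rw [← powMap_id]
      exact powMap_heq T (Del.zero_sum _) rfl
        (Del.hom_heq (Del.zero_sum _) rfl fun i hi hi' => (Nat.lt_one_iff.1 hi').symm)
    rw [Strict.rightUnitor_eqToIso, eqToIso.hom]
    exact eq_of_heq (h₂.trans (h₃.trans (eqToHom_heq_id_cod _ _ _).symm))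
  mul_mul := by
    have e := pow_sum T ⟨1⟩ ⟨1⟩
    have h₀ := eqToHom_comp_heq (powMap T (Del.bang (Del.sum ⟨1⟩ ⟨1⟩))) e.symm
    have h₁ := (whiskerRight_heq (f := pow T ⟨1⟩) rfl e.symm rfl h₀).trans
        (powMap_id_sumHom T _ _).symm
    have h₂ := (whiskerLeft_heq (f := pow T ⟨1⟩) rfl e.symm rfl h₀).trans
        (powMap_sumHom_id T _ _).symm
    have h₃ := heq_comp ((congrArg (· ≫ pow T ⟨1⟩) e.symm).trans (pow_sum T ⟨1⟩ _).symm)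
      e.symm rfl h₁ h₀
    have h₄ := heq_comp ((congrArg (pow T ⟨1⟩ ≫ ·) e.symm).trans (pow_sum T _ ⟨1⟩).symm)
      e.symm rfl h₂ h₀
    rw [← powMap_comp, Del.hom_one_ext (_ ≫ _) (Del.bang _)] at h₃ h₄
    rw [Strict.associator_eqToIso, eqToIso.hom]
    exact eq_of_heq (h₃.trans (h₄.symm.trans (eqToHom_comp_heq _ _).symm))

theorem monadOf_unit_heq : (monadOf T).unit ≍ powMap T (Del.bang ⟨0⟩) := eqToHom_comp_heq _ _

theorem monadOf_mul_heq : (monadOf T).mul ≍ powMap T (Del.bang (Del.sum ⟨1⟩ ⟨1⟩)) :=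
  eqToHom_comp_heq _ _

end CellPowers

/-! ### Colax morphisms into identity monads as modules. -/

namespace Mnd

variable {B : Type u} [Bicategory.{w, v} B] {S : Mnd B} {X : B}

/-- The action on a colax morphism into an identity monad. -/
def act (F : S ⟶ idMonad X) : S.t ≫ F.map ⟶ F.map := F.swap ≫ (ρ_ F.map).hom

/-- Composing with the right unitor removes the identity monad from the colax axioms, which become
the unit law here and the associativity law in `mul_act`. -/
theorem unit_act (F : S ⟶ idMonad X) : S.unit ▷ F.map ≫ act F = (λ_ F.map).hom := by
  rw [act, reassoc_of% F.unit_swap]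
  simp

theorem mul_act (F : S ⟶ idMonad X) :
    S.mul ▷ F.map ≫ act F = (α_ S.t S.t F.map).hom ≫ S.t ◁ act F ≫ act F := by
  rw [act, reassoc_of% F.mul_swap]
  -- The multiplication of the identity monad is a unitor, so the triangle identity absorbs it.
  have h : (α_ F.map (𝟙 X) (𝟙 X)).hom ≫ F.map ◁ (λ_ (𝟙 X)).hom = (ρ_ F.map).hom ▷ 𝟙 X :=
    triangle _ _
  simp only [whiskerLeft_comp, Category.assoc]
  rw [reassoc_of% h, ← comp_whiskerRight_assoc, rightUnitor_naturality]
  simp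

/-- A colax morphism into an identity monad from an action. -/
def ofAct (f : S.carrier ⟶ X) (a : S.t ≫ f ⟶ f) (hu : S.unit ▷ f ≫ a = (λ_ f).hom)
    (hm : S.mul ▷ f ≫ a = (α_ S.t S.t f).hom ≫ S.t ◁ a ≫ a) : S ⟶ idMonad X where
  map := f
  swap := a ≫ (ρ_ f).inv
  unit_swap := by rw [reassoc_of% hu]; simp
  mul_swap := by
    rw [reassoc_of% hm]
    simp

@[simp]
theorem act_ofAct (f : S.carrier ⟶ X) (a : S.t ≫ f ⟶ f) (hu hm) :
    act (ofAct f a hu hm) = a := by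
  simp [act, ofAct]

theorem hom_ext_act {F G : S ⟶ idMonad X} (h : F.map = G.map) (ha : act F ≍ act G) : F = G := by
  obtain ⟨f, sf, _, _⟩ := F
  obtain ⟨g, sg, _, _⟩ := G
  dsimp at h
  subst h
  have : sf = sg := by
    rw [← cancel_mono (ρ_ f).hom]
    exact eq_of_heq ha
  subst this
  rfl

theorem act_cell {F G : S ⟶ idMonad X} (σ : F ⟶ G) : act F ≫ σ.cell = S.t ◁ σ.cell ≫ act G := by
  have := σ.comm
  simp only [act, Category.assoc, ← reassoc_of% this, ← rightUnitor_naturality]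

/-- A transformation from a `2`-cell commuting with the actions. -/
def ofCell {F G : S ⟶ idMonad X} (σ : F.map ⟶ G.map)
    (h : act F ≫ σ = S.t ◁ σ ≫ act G) : F ⟶ G where
  cell := σ
  comm := by
    rw [← cancel_mono (ρ_ G.map).hom]
    simpa only [act, Category.assoc, rightUnitor_naturality] using h

theorem act_comp_idMonadMap {Y : B} (F : S ⟶ idMonad X) (f : X ⟶ Y) :
    act (F ≫ idMonadMap f) = (α_ S.t F.map f).inv ≫ act F ▷ f := by
  change ((α_ S.t F.map f).inv ≫ F.swap ▷ f ≫ (α_ F.map (𝟙 X) f).hom ≫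
    F.map ◁ ((λ_ f).hom ≫ (ρ_ f).inv) ≫ (α_ F.map f (𝟙 Y)).inv) ≫ (ρ_ (F.map ≫ f)).hom = _
  simp [act]

theorem hom₂_heq {S T : Mnd B} {F G F' G' : S ⟶ T} {σ : F ⟶ G} {τ : F' ⟶ G'} (hF : F = F')
    (hG : G = G') (h : σ.cell ≍ τ.cell) : σ ≍ τ := by
  subst hF hG
  exact heq_of_eq (hom₂_ext (eq_of_heq h))

end Mnd

theorem CatNat.hom_heq {B : Type u} [Bicategory.{w, v} B] {F : StrictPseudofunctor B Cat.{v₁, u₁}}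
    {G : StrictPseudofunctor B Cat.{v₂, u₂}} {α β α' β' : CatNat F G} {m : α ⟶ β} {n : α' ⟶ β'}
    (hα : α = α') (hβ : β = β') (h : ∀ X x, (m.app X).app x ≍ (n.app X).app x) : m ≍ n := by
  subst hα hβ
  exact heq_of_eq (CatNat.hom_ext fun X => NatTrans.ext (funext fun x => eq_of_heq (h X x)))

/-! ### From an action to a functor on `Π_r`. -/

section Extend

variable {D : Type u} [Bicategory.{w, v} D]

/-- An object of `X` with an action of the monad given by `T`. -/
structure Action (T : StrictPseudofunctor BDel D) (X : D) where
  map : T.obj .star ⟶ X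
  act : pow T ⟨1⟩ ≫ map ⟶ map
  unit_act : powMap T (Del.bang ⟨0⟩) ▷ map ≫ act ≍ 𝟙 map
  mul_act : powMap T (Del.bang (Del.sum ⟨1⟩ ⟨1⟩)) ▷ map ≫ act ≍ pow T ⟨1⟩ ◁ act ≫ act

namespace Action

variable [Bicategory.Strict D] {T : StrictPseudofunctor BDel D} {X : D} (F : Action T X)

theorem pow_sum_comp (m n : Del) :
    pow T (Del.sum m n) ≫ F.map = pow T n ≫ pow T m ≫ F.map := by
  rw [pow_sum, Strict.assoc]

/-- The action of `T 1`, whiskered by `T n`. -/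
def actPow (n : Del) : pow T (Del.sum ⟨1⟩ n) ≫ F.map ⟶ pow T n ≫ F.map :=
  eqToHom (F.pow_sum_comp ⟨1⟩ n) ≫ pow T n ◁ F.act

theorem actPow_heq (n : Del) : F.actPow n ≍ pow T n ◁ F.act := eqToHom_comp_heq _ _

/-- The interchange law: the action takes place on the summand `1`, while `f` acts on the other
summand. -/
theorem actPow_naturality {m n : Del} (f : m ⟶ n) :
    F.actPow m ≫ powMap T f ▷ F.map =
      powMap T (Del.sumHom (𝟙 (⟨1⟩ : Del)) f) ▷ F.map ≫ F.actPow n := by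
  apply eq_of_heq
  refine (heq_comp (F.pow_sum_comp ⟨1⟩ m) rfl rfl (F.actPow_heq m) HEq.rfl).trans ?_
  rw [whisker_exchange]
  refine heq_comp (F.pow_sum_comp ⟨1⟩ m).symm (F.pow_sum_comp ⟨1⟩ n).symm rfl ?_
    (F.actPow_heq n).symm
  exact (whiskerRight_comp_heq _ _ _).trans (whiskerRight_heq rfl (pow_sum T _ _).symm
    (pow_sum T _ _).symm (powMap_id_sumHom T f ⟨1⟩).symm)

theorem actPow_sum (m n : Del) : F.actPow (Del.sum m n) ≍ pow T n ◁ F.actPow m := by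
  refine (F.actPow_heq _).trans ?_
  refine (whiskerLeft_heq (pow_sum T m n) rfl rfl HEq.rfl).trans ?_
  refine (comp_whiskerLeft_heq _ _ _).trans ?_
  exact whiskerLeft_heq rfl (F.pow_sum_comp ⟨1⟩ m).symm rfl (F.actPow_heq m).symm

theorem act_heq_actPow : F.act ≍ F.actPow ⟨0⟩ := by
  refine HEq.trans ?_ (F.actPow_heq _).symm
  refine HEq.trans (id_whiskerLeft_heq _).symm ?_
  exact whiskerLeft_heq (pow_zero T).symm rfl rfl HEq.rfl

/-- The unit law of the action whiskered by `T n`. As `succ` is the Kleisli identity, this is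
preservation of identities by `extend`. -/
theorem succ_actPow (n : Del) : powMap T (Del.succ n) ▷ F.map ≫ F.actPow n = 𝟙 _ := by
  apply eq_of_heq
  have h₁ : powMap T (Del.succ n) ≍ pow T n ◁ powMap T (Del.bang ⟨0⟩) :=
    (powMap_heq T (Del.zero_sum n).symm rfl (Del.succ_heq n)).trans
      (powMap_sumHom_id T (Del.bang ⟨0⟩) n)
  have e : pow T n = pow T n ≫ pow T ⟨0⟩ := by rw [pow_zero, Strict.comp_id]
  have h₂ : powMap T (Del.succ n) ▷ F.map ≍ pow T n ◁ powMap T (Del.bang ⟨0⟩) ▷ F.map :=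
    (whiskerRight_heq rfl e (pow_sum T _ _) h₁).trans (whisker_assoc_heq _ _ _)
  refine (heq_comp ((congrArg (· ≫ F.map) e).trans (Strict.assoc _ _ _)) (F.pow_sum_comp ⟨1⟩ n) rfl
    h₂ (F.actPow_heq n)).trans ?_
  rw [← whiskerLeft_comp, ← whiskerLeft_id]
  exact whiskerLeft_heq rfl (by rw [pow_zero, Strict.id_comp]) rfl F.unit_act

/-- The associativity law whiskered by `T n`; it is what makes `extend` compatible with Kleisli
composition. -/
theorem pred_actPow (n : Del) : powMap T (Del.pred n) ▷ F.map ≫ F.actPow n =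
    F.actPow (Del.sum ⟨1⟩ n) ≫ F.actPow n := by
  apply eq_of_heq
  have e : pow T (Del.sum ⟨1⟩ (Del.sum ⟨1⟩ n)) = pow T n ≫ pow T (Del.sum ⟨1⟩ ⟨1⟩) := by
    rw [pow_sum, pow_sum, pow_sum, Strict.assoc]
  have h₁ : powMap T (Del.pred n) ≍ pow T n ◁ powMap T (Del.bang (Del.sum ⟨1⟩ ⟨1⟩)) :=
    (powMap_heq T (Del.sum_assoc ⟨1⟩ ⟨1⟩ n).symm rfl (Del.pred_heq n)).trans
      (powMap_sumHom_id T _ n)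
  have h₂ : powMap T (Del.pred n) ▷ F.map ≍
      pow T n ◁ powMap T (Del.bang (Del.sum ⟨1⟩ ⟨1⟩)) ▷ F.map :=
    (whiskerRight_heq rfl e (pow_sum T _ _) h₁).trans (whisker_assoc_heq _ _ _)
  refine (heq_comp ((congrArg (· ≫ F.map) e).trans (Strict.assoc _ _ _)) (F.pow_sum_comp ⟨1⟩ n) rfl
    h₂ (F.actPow_heq n)).trans ?_
  rw [← whiskerLeft_comp]
  refine (whiskerLeft_heq rfl (F.pow_sum_comp ⟨1⟩ ⟨1⟩) rfl F.mul_act).trans ?_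
  rw [whiskerLeft_comp]
  refine heq_comp ?_ (F.pow_sum_comp ⟨1⟩ n).symm rfl ?_ (F.actPow_heq n).symm
  · rw [pow_sum, pow_sum, Strict.assoc, Strict.assoc]
  · refine HEq.trans ?_ (F.actPow_heq _).symm
    refine (comp_whiskerLeft_heq _ _ _).symm.trans ?_
    exact whiskerLeft_heq (pow_sum T _ _).symm rfl rfl HEq.rfl

/-- The functor on `Π_r` given by an action of the monad. -/
def extend : PiR ⥤ (T.obj .star ⟶ X) where
  obj k := pow T ⟨k.card⟩ ≫ F.map
  map {k l} g := powMap T (PiR.toDel g) ▷ F.map ≫ F.actPow ⟨l.card⟩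
  map_id k := F.succ_actPow ⟨k.card⟩
  map_comp {k l m} g h := by
    -- After expanding the Kleisli composite, `pred` is replaced by two successive actions, and the
    -- first of them slides past the total part of `h` by naturality.
    rw [PiR.toDel_comp, powMap_comp, powMap_comp, comp_whiskerRight, comp_whiskerRight,
      Category.assoc, Category.assoc, Category.assoc, reassoc_of% (F.actPow_naturality),
      pred_actPow]

theorem extend_obj_add (k : PiR) (n : Del) :
    F.extend.obj (PiR.add k n) = pow T n ≫ F.extend.obj k :=
  F.pow_sum_comp ⟨k.card⟩ n

theorem extend_map_addHom_left {k l : PiR} (g : k ⟶ l) (n : Del) :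
    F.extend.map (PiR.addHom g (𝟙 n)) ≍ pow T n ◁ F.extend.map g := by
  have h₁ : powMap T (PiR.toDel (PiR.addHom g (𝟙 n))) ≍ pow T n ◁ powMap T (PiR.toDel g) :=
    (powMap_heq T rfl (Del.sum_assoc ⟨1⟩ ⟨l.card⟩ n).symm (PiR.toDel_addHom g (𝟙 n))).trans
      (powMap_sumHom_id T _ n)
  have e : pow T (Del.sum ⟨1⟩ ⟨l.card + n.card⟩) = pow T n ≫ pow T (Del.sum ⟨1⟩ ⟨l.card⟩) := by
    rw [← pow_sum, Del.sum_assoc]; rfl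
  have h₂ := (whiskerRight_heq (f := F.map) rfl (pow_sum T ⟨k.card⟩ n) e h₁).trans
    (whisker_assoc_heq _ _ _)
  exact (heq_comp (F.pow_sum_comp ⟨k.card⟩ n) ((congrArg (· ≫ F.map) e).trans
    (Strict.assoc _ _ _)) (F.pow_sum_comp ⟨l.card⟩ n) h₂ (F.actPow_sum ⟨l.card⟩ n)).trans
      (heq_of_eq (whiskerLeft_comp _ _ _).symm)

theorem extend_map_addHom_right (k : PiR) {m n : Del} (f : m ⟶ n) :
    F.extend.map (PiR.addHom (𝟙 k) f) ≍ powMap T f ▷ F.extend.obj k := by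
  -- Quantifying over `q` allows `(k + n)` in `Π_r` and in `Δ` to be matched by definitional
  -- unfolding before rewriting.
  have h : ∀ q, q = Del.sumHom (𝟙 (⟨k.card⟩ : Del)) f ≫ Del.succ (Del.sum ⟨k.card⟩ n) →
      powMap T q ▷ F.map ≫ F.actPow (Del.sum ⟨k.card⟩ n) ≍
        powMap T f ▷ (pow T ⟨k.card⟩ ≫ F.map) := by
    rintro _ rfl
    rw [powMap_comp, comp_whiskerRight, Category.assoc, succ_actPow, Category.comp_id]
    exact (whiskerRight_heq rfl (pow_sum T _ _) (pow_sum T _ _)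
      (powMap_id_sumHom T f ⟨k.card⟩)).trans (whiskerRight_comp_heq _ _ _).symm
  exact h _ (PiR.toDel_id_addHom k f)

/-- Actions of the monad given by `T` are colax morphisms into identity monads. -/
def toHom : monadOf T ⟶ Mnd.idMonad X :=
  Mnd.ofAct (S := monadOf T) F.map F.act
    (eq_of_heq <| by
      refine (heq_comp (congrArg (· ≫ F.map) (pow_zero T).symm) rfl rfl (whiskerRight_heq rfl
        (pow_zero T).symm rfl (monadOf_unit_heq T)) HEq.rfl).trans (F.unit_act.trans ?_)
      exact (leftUnitor_hom_heq _).symm)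
    (eq_of_heq <| by
      refine (heq_comp (congrArg (· ≫ F.map) (pow_sum T _ _).symm) rfl rfl (whiskerRight_heq rfl
        (pow_sum T _ _).symm rfl (monadOf_mul_heq T)) HEq.rfl).trans (F.mul_act.trans ?_)
      exact (associator_hom_comp_heq _ _ _ _).symm)

theorem act_toHom : Mnd.act F.toHom = F.act := Mnd.act_ofAct (S := monadOf T) _ _ _ _

/-- The action given by a colax morphism into an identity monad. -/
def ofHom (F : monadOf T ⟶ Mnd.idMonad X) : Action T X where
  map := F.map
  act := Mnd.act F
  unit_act := by
    refine HEq.trans ?_ ((heq_of_eq (Mnd.unit_act F)).trans ?_)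
    · exact heq_comp (congrArg (· ≫ F.map) (pow_zero T)) rfl rfl (whiskerRight_heq rfl
        (pow_zero T) rfl (monadOf_unit_heq T).symm) HEq.rfl
    · exact leftUnitor_hom_heq _
  mul_act := by
    refine HEq.trans ?_ ((heq_of_eq (Mnd.mul_act F)).trans ?_)
    · exact heq_comp (congrArg (· ≫ F.map) (pow_sum T _ _)) rfl rfl (whiskerRight_heq rfl
        (pow_sum T _ _) rfl (monadOf_mul_heq T).symm) HEq.rfl
    · exact associator_hom_comp_heq _ _ _ _

theorem ofHom_toHom : ofHom F.toHom = F := by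
  have h := F.act_toHom
  unfold ofHom
  cases F
  congr

end Action

end Extend

/-! ### Weighted cocones are colax morphisms into identity monads. -/

section Cocones

variable {D : Type u} [Bicategory.{w, v} D] [Bicategory.Strict D]
  {T : StrictPseudofunctor BDel D} {X : D}

namespace CatNat

/-- The functor underlying a `W_r`-weighted cocone. -/
def fiber (α : CatNat weightR (homInto T X)) : PiR ⥤ (T.obj .star ⟶ X) := α.app (op .star)

/-- This and the next two lemmas unpack 2-naturality over the one object: equivariance of `fiber`
under the action of `Δ` on objects, on morphisms and along 2-cells. -/
theorem fiber_obj_add (α : CatNat weightR (homInto T X)) (k : PiR) (n : Del) :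
    α.fiber.obj (PiR.add k n) = pow T n ≫ α.fiber.obj k :=
  Functor.congr_obj (α.naturality (X := op .star) (Y := op .star)
    (Quiver.Hom.op (V := BDel) (X := .star) (Y := .star) n)) k

theorem fiber_map_addHom_left (α : CatNat weightR (homInto T X)) {k l : PiR} (g : k ⟶ l)
    (n : Del) : α.fiber.map (PiR.addHom g (𝟙 n)) ≍ pow T n ◁ α.fiber.map g :=
  Functor.hcongr_hom (α.naturality (X := op .star) (Y := op .star)
    (Quiver.Hom.op (V := BDel) (X := .star) (Y := .star) n)) g

theorem fiber_map_addHom_right (α : CatNat weightR (homInto T X)) (k : PiR) {m n : Del}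
    (f : m ⟶ n) : α.fiber.map (PiR.addHom (𝟙 k) f) ≍ powMap T f ▷ α.fiber.obj k :=
  α.naturality₂_heq (X := op .star) (Y := op .star)
    (f := Quiver.Hom.op (V := BDel) (X := .star) (Y := .star) m)
    (g := Quiver.Hom.op (V := BDel) (X := .star) (Y := .star) n) (Bicategory.Opposite.op2 f) k

theorem fiber_ext {α β : CatNat weightR (homInto T X)} (h : α.fiber = β.fiber) : α = β :=
  ext_app (by rintro ⟨⟨⟩⟩; exact h)

/-- The natural transformation underlying a modification of `W_r`-weighted cocones. -/
def fiberMap {α β : CatNat weightR (homInto T X)} (m : α ⟶ β) : α.fiber ⟶ β.fiber :=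
  m.app (op .star)

theorem fiberMap_heq {α β : CatNat weightR (homInto T X)} (m : α ⟶ β) (k : PiR) (n : Del) :
    (fiberMap m).app (PiR.add k n) ≍ pow T n ◁ (fiberMap m).app k :=
  (heq_of_eq (m.naturality (X := op .star) (Y := op .star)
    (Quiver.Hom.op (V := BDel) (X := .star) (Y := .star) n) k)).trans (conj_heq _ _ _)

theorem fiberMap_ext {α β α' β' : CatNat weightR (homInto T X)} {m : α ⟶ β} {n : α' ⟶ β'}
    (hα : α = α') (hβ : β = β') (h : ∀ k, (fiberMap m).app k ≍ (fiberMap n).app k) : m ≍ n :=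
  hom_heq hα hβ (by rintro ⟨⟨⟩⟩ k; exact h k)

/-- The action given by a cocone. -/
def toAction (α : CatNat weightR (homInto T X)) : Action T X where
  map := α.fiber.obj ⟨0⟩
  act := eqToHom (α.fiber_obj_add ⟨0⟩ ⟨1⟩).symm ≫ α.fiber.map (PiR.undef (PiR.add ⟨0⟩ ⟨1⟩) ⟨0⟩)
  unit_act := by
    refine (heq_comp (α.fiber_obj_add ⟨0⟩ ⟨0⟩).symm (α.fiber_obj_add ⟨0⟩ ⟨1⟩).symm rfl
      (α.fiber_map_addHom_right ⟨0⟩ (Del.bang ⟨0⟩)).symm (eqToHom_comp_heq _ _)).trans ?_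
    -- The composite `0 → 1 → 0` in `Π_r` must be the identity, since `0` is terminal.
    rw [← Functor.map_comp]
    exact heq_of_eq ((congrArg α.fiber.map (PiR.hom_zero_ext _ (𝟙 _))).trans (α.fiber.map_id ⟨0⟩))
  mul_act := by
    refine (heq_comp (α.fiber_obj_add ⟨0⟩ _).symm (α.fiber_obj_add ⟨0⟩ ⟨1⟩).symm rfl
      (α.fiber_map_addHom_right ⟨0⟩ (Del.bang _)).symm (eqToHom_comp_heq _ _)).trans ?_
    have e := α.fiber_obj_add ⟨0⟩ ⟨1⟩
    have h := (α.fiber_map_addHom_left (PiR.undef (PiR.add ⟨0⟩ ⟨1⟩) ⟨0⟩) ⟨1⟩).trans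
      (whiskerLeft_heq rfl e rfl (eqToHom_comp_heq _ e.symm).symm)
    refine HEq.trans ?_ (heq_comp ((α.fiber_obj_add (PiR.add ⟨0⟩ ⟨1⟩) ⟨1⟩).trans
      (congrArg (pow T ⟨1⟩ ≫ ·) e)) e rfl h (eqToHom_comp_heq _ e.symm).symm)
    -- Both sides are images of maps from `2` to `0`: one merges the two points before forgetting,
    -- the other forgets them one at a time.
    rw [← Functor.map_comp, ← Functor.map_comp]
    exact heq_of_eq (congrArg α.fiber.map (PiR.hom_zero_ext _ _))

theorem toAction_act_heq (α : CatNat weightR (homInto T X)) :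
    α.toAction.act ≍ α.fiber.map (PiR.undef (PiR.add ⟨0⟩ ⟨1⟩) ⟨0⟩) := eqToHom_comp_heq _ _

theorem toAction_act_comp {α β : CatNat weightR (homInto T X)} (m : α ⟶ β) :
    α.toAction.act ≫ (fiberMap m).app ⟨0⟩ =
      pow T ⟨1⟩ ◁ (fiberMap m).app ⟨0⟩ ≫ β.toAction.act := by
  apply eq_of_heq
  have e := fun γ : CatNat weightR (homInto T X) => (γ.fiber_obj_add ⟨0⟩ ⟨1⟩).symm
  refine (heq_comp (e α) rfl rfl α.toAction_act_heq HEq.rfl).trans ?_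
  refine (heq_of_eq ((fiberMap m).naturality _)).trans ?_
  exact heq_comp (e α).symm (e β).symm rfl (fiberMap_heq m ⟨0⟩ ⟨1⟩) β.toAction_act_heq.symm

/-- By equivariance a cocone is known on maps `0 + f` and on `(1 → 0) + l`, and by `PiR.factor`
these generate. Hence it is recovered from its action. -/
theorem extend_toAction (α : CatNat weightR (homInto T X)) : α.toAction.extend = α.fiber := by
  have e₀ : ∀ k : PiR, α.toAction.extend.obj k = α.fiber.obj (PiR.add ⟨0⟩ ⟨k.card⟩) := fun k =>
    (α.fiber_obj_add ⟨0⟩ ⟨k.card⟩).symm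
  have e : ∀ k : PiR, α.toAction.extend.obj k = α.fiber.obj k := fun k =>
    (e₀ k).trans (congrArg α.fiber.obj (PiR.zero_add k))
  refine Functor.hext e fun k l g => ?_
  refine HEq.trans ?_ (functor_map_heq α.fiber (PiR.zero_add k) (PiR.zero_add l) (PiR.factor g))
  rw [Functor.map_comp]
  refine heq_comp (e₀ k) (α.fiber_obj_add ⟨0⟩ _).symm (e₀ l)
    (α.fiber_map_addHom_right ⟨0⟩ (PiR.toDel g)).symm ?_
  rw [Functor.map_comp, eqToHom_map]
  refine HEq.trans ?_ (eqToHom_comp_heq _ _).symm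
  refine (α.toAction.actPow_heq _).trans ?_
  refine HEq.trans ?_ (α.fiber_map_addHom_left _ _).symm
  exact whiskerLeft_heq rfl (α.fiber_obj_add ⟨0⟩ ⟨1⟩).symm rfl α.toAction_act_heq

end CatNat

namespace Action

/-- The components of the cocone given by an action. -/
def component (F : Action T X) : ∀ b : BDel, PiR ⥤ (T.obj b ⟶ X)
  | .star => F.extend

/-- The cocone given by an action. -/
def toCocone (F : Action T X) : CatNat weightR (homInto T X) where
  app b := F.component b.unop
  naturality := by
    rintro ⟨⟨⟩⟩ ⟨⟨⟩⟩ f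
    exact Functor.hext (fun k => F.extend_obj_add k f.unop)
      (fun k l g => F.extend_map_addHom_left g f.unop)
  naturality₂ := by
    rintro ⟨⟨⟩⟩ ⟨⟨⟩⟩ f g η k
    exact heq_conj (F.extend_map_addHom_right k η.unop2)

theorem actPow_comp {F G : Action T X} {σ : F.map ⟶ G.map}
    (h : F.act ≫ σ = pow T ⟨1⟩ ◁ σ ≫ G.act) (n : Del) :
    F.actPow n ≫ pow T n ◁ σ = pow T (Del.sum ⟨1⟩ n) ◁ σ ≫ G.actPow n := by
  apply eq_of_heq
  refine (heq_comp (F.pow_sum_comp ⟨1⟩ n) rfl rfl (F.actPow_heq n) HEq.rfl).trans ?_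
  rw [← whiskerLeft_comp, h, whiskerLeft_comp]
  refine heq_comp (F.pow_sum_comp ⟨1⟩ n).symm (G.pow_sum_comp ⟨1⟩ n).symm rfl ?_
    (G.actPow_heq n).symm
  exact (comp_whiskerLeft_heq _ _ _).symm.trans
    (whiskerLeft_heq (pow_sum T _ _).symm rfl rfl HEq.rfl)

/-- The natural transformation given by a compatible `2`-cell. -/
def extendMap {F G : Action T X} (σ : F.map ⟶ G.map) (h : F.act ≫ σ = pow T ⟨1⟩ ◁ σ ≫ G.act) :
    F.extend ⟶ G.extend where
  app k := pow T ⟨k.card⟩ ◁ σ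
  naturality k l g := by
    change (powMap T (PiR.toDel g) ▷ F.map ≫ F.actPow ⟨l.card⟩) ≫ pow T ⟨l.card⟩ ◁ σ =
      pow T ⟨k.card⟩ ◁ σ ≫ powMap T (PiR.toDel g) ▷ G.map ≫ G.actPow ⟨l.card⟩
    rw [Category.assoc, actPow_comp h, whisker_exchange_assoc]

theorem extendMap_app_add {F G : Action T X} (σ : F.map ⟶ G.map)
    (h : F.act ≫ σ = pow T ⟨1⟩ ◁ σ ≫ G.act) (k : PiR) (n : Del) :
    (extendMap σ h).app (PiR.add k n) ≍ pow T n ◁ (extendMap σ h).app k :=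
  (whiskerLeft_heq (pow_sum T ⟨k.card⟩ n) rfl rfl HEq.rfl).trans (comp_whiskerLeft_heq _ _ _)

/-- The components of the modification given by a compatible `2`-cell. -/
def componentMap {F G : Action T X} (σ : F.map ⟶ G.map)
    (h : F.act ≫ σ = pow T ⟨1⟩ ◁ σ ≫ G.act) : ∀ b : BDel, F.component b ⟶ G.component b
  | .star => extendMap σ h

/-- The modification given by a compatible `2`-cell. -/
def toCoconeMap {F G : Action T X} (σ : F.map ⟶ G.map)
    (h : F.act ≫ σ = pow T ⟨1⟩ ◁ σ ≫ G.act) : F.toCocone ⟶ G.toCocone where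
  app b := componentMap σ h b.unop
  naturality := by
    rintro ⟨⟨⟩⟩ ⟨⟨⟩⟩ f k
    exact heq_conj (extendMap_app_add σ h k f.unop)

end Action

variable (T X)

/-- Restriction of cocones to colax morphisms. -/
def restrict : CatNat weightR (homInto T X) ⥤ (monadOf T ⟶ Mnd.idMonad X) where
  obj α := α.toAction.toHom
  map {α β} m := Mnd.ofCell (S := monadOf T) ((CatNat.fiberMap m).app ⟨0⟩) <|
    (congrArg (· ≫ (CatNat.fiberMap m).app ⟨0⟩) α.toAction.act_toHom).trans <|
      (CatNat.toAction_act_comp m).trans <|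
        congrArg (pow T ⟨1⟩ ◁ (CatNat.fiberMap m).app ⟨0⟩ ≫ ·) β.toAction.act_toHom.symm
  map_id _ := Mnd.hom₂_ext rfl
  map_comp _ _ := Mnd.hom₂_ext rfl

/-- Extension of colax morphisms to cocones. -/
def coextend : (monadOf T ⟶ Mnd.idMonad X) ⥤ CatNat weightR (homInto T X) where
  obj F := (Action.ofHom F).toCocone
  map {F G} σ :=
    Action.toCoconeMap (F := Action.ofHom F) (G := Action.ofHom G) σ.cell (Mnd.act_cell σ)
  map_id F := by
    apply CatNat.hom_ext
    rintro ⟨⟨⟩⟩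
    exact NatTrans.ext (funext fun k => whiskerLeft_id _ _)
  map_comp σ τ := by
    apply CatNat.hom_ext
    rintro ⟨⟨⟩⟩
    exact NatTrans.ext (funext fun k => whiskerLeft_comp _ _ _)

theorem coextend_obj_restrict_obj (α : CatNat weightR (homInto T X)) :
    (coextend T X).obj ((restrict T X).obj α) = α :=
  CatNat.fiber_ext ((congrArg Action.extend α.toAction.ofHom_toHom).trans α.extend_toAction)

theorem restrict_coextend : restrict T X ⋙ coextend T X = 𝟭 _ := by
  refine Functor.hext (coextend_obj_restrict_obj T X) fun α β m => ?_
  refine CatNat.fiberMap_ext (coextend_obj_restrict_obj T X α) (coextend_obj_restrict_obj T X β)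
    fun k => ?_
  -- A modification is determined by its component at `0`, because every object of `Π_r` is `0 + k`.
  refine (CatNat.fiberMap_heq m ⟨0⟩ ⟨k.card⟩).symm.trans ?_
  rw [PiR.zero_add]
  rfl

/-- The Kleisli form of `1 → 0` is the identity of `1 + 0 = 1`, so the extended functor sends it to
the original action. -/
theorem restrict_obj_coextend_obj (F : monadOf T ⟶ Mnd.idMonad X) :
    (restrict T X).obj ((coextend T X).obj F) = F := by
  have e : pow T ⟨0⟩ ≫ F.map = F.map :=
    (congrArg (· ≫ F.map) (pow_zero T)).trans (Strict.id_comp _)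
  refine Mnd.hom_ext_act e ?_
  refine (heq_of_eq (Action.act_toHom _)).trans ?_
  refine (CatNat.toAction_act_heq _).trans ?_
  refine HEq.trans ?_ (Action.ofHom F).act_heq_actPow.symm
  have h : PiR.toDel (PiR.undef (PiR.add ⟨0⟩ ⟨1⟩) ⟨0⟩) = 𝟙 (⟨1⟩ : Del) := Del.hom_one_ext _ _
  have h' : ∀ q, q = 𝟙 (⟨1⟩ : Del) → powMap T q ▷ (Action.ofHom F).map ≫
      (Action.ofHom F).actPow ⟨0⟩ = (Action.ofHom F).actPow ⟨0⟩ := by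
    rintro _ rfl
    rw [powMap_id, id_whiskerRight]
    exact Category.id_comp _
  exact heq_of_eq (h' _ h)

theorem coextend_restrict : coextend T X ⋙ restrict T X = 𝟭 _ := by
  refine Functor.hext (restrict_obj_coextend_obj T X) fun F G σ => ?_
  refine Mnd.hom₂_heq (restrict_obj_coextend_obj T X F) (restrict_obj_coextend_obj T X G) ?_
  exact (whiskerLeft_heq (pow_zero T) rfl rfl HEq.rfl).trans (id_whiskerLeft_heq σ.cell)

theorem restrict_obj_coconeMap {X Y : D} (f : X ⟶ Y) (α : CatNat weightR (homInto T X)) :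
    (restrict T Y).obj ((coconeMap weightR T f).obj α) =
      (restrict T X).obj α ≫ Mnd.idMonadMap f := by
  refine Mnd.hom_ext_act rfl ?_
  rw [Mnd.act_comp_idMonadMap]
  refine (heq_of_eq (Action.act_toHom _)).trans ?_
  refine (CatNat.toAction_act_heq _).trans ?_
  refine HEq.trans ?_ (associator_inv_comp_heq _ _ _ _).symm
  exact whiskerRight_heq rfl (α.fiber_obj_add ⟨0⟩ ⟨1⟩) rfl
    (α.toAction_act_heq.symm.trans (heq_of_eq α.toAction.act_toHom.symm))

/-- Cocones weighted by `W_r` are colax morphisms into identity monads. -/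
def coconeIso : CatNatIso (cocone weightR T) ((Mnd.incl D).comp (homFrom (monadOf T))) where
  app X := restrict T X
  inv X := coextend T X
  app_inv X := restrict_coextend T X
  inv_app X := coextend_restrict T X
  -- On morphisms both routes give the component at `0` whiskered by `f`, so only objects need an
  -- argument.
  naturality f := Functor.hext (restrict_obj_coconeMap T f) fun α β _ =>
    Mnd.hom₂_heq (restrict_obj_coconeMap T f α) (restrict_obj_coconeMap T f β) HEq.rfl
  naturality₂ {_ _ f g} _ α := heq_conj (Mnd.hom₂_heq (restrict_obj_coconeMap T f α)
    (restrict_obj_coconeMap T g α) HEq.rfl)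

end Cocones

/-! ### Normal forms of monotone maps: lattice paths. -/

namespace Del

/-- A monotone map with an added top element in the codomain. -/
def skip {m n : ℕ} (f : (⟨m⟩ : Del) ⟶ ⟨n⟩) : (⟨m⟩ : Del) ⟶ ⟨n + 1⟩ where
  toFun i := ⟨(f.toFun i).val, Nat.lt_succ_of_lt (f.toFun i).isLt⟩
  mono _ _ h := f.mono h

/-- A monotone map with an added top element in the domain, sent to the top element. -/
def push {m n : ℕ} (f : (⟨m⟩ : Del) ⟶ ⟨n + 1⟩) : (⟨m + 1⟩ : Del) ⟶ ⟨n + 1⟩ where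
  toFun i := if h : i.val < m then f.toFun ⟨i.val, h⟩ else ⟨n, Nat.lt_succ_self n⟩
  mono i j hij := by
    dsimp only
    rw [Fin.le_def] at hij
    split_ifs with h₁ h₂ h₂
    · exact f.mono (show (⟨i.val, h₁⟩ : Fin m) ≤ ⟨j.val, h₂⟩ from hij)
    · exact Nat.le_of_lt_succ (f.toFun ⟨i.val, h₁⟩).isLt
    · omega
    · exact le_rfl

theorem push_lt {m n : ℕ} (f : (⟨m⟩ : Del) ⟶ ⟨n + 1⟩) {i : ℕ} (hi : i < m + 1) (h : i < m) :
    (push f).toFun ⟨i, hi⟩ = f.toFun ⟨i, h⟩ := dif_pos h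

theorem push_last {m n : ℕ} (f : (⟨m⟩ : Del) ⟶ ⟨n + 1⟩) {i : ℕ} (hi : i < m + 1) (h : ¬ i < m) :
    ((push f).toFun ⟨i, hi⟩).val = n := congrArg Fin.val (dif_neg h)

/-- Lattice paths, encoding monotone maps. -/
inductive Path : ℕ → ℕ → Type
  | nil : Path 0 0
  | skip {m n : ℕ} (p : Path m n) : Path m (n + 1)
  | push {m n : ℕ} (p : Path m (n + 1)) : Path (m + 1) (n + 1)

namespace Path

/-- The monotone map encoded by a path. -/
def toHom : ∀ {m n : ℕ}, Path m n → ((⟨m⟩ : Del) ⟶ ⟨n⟩)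
  | _, _, nil => 𝟙 _
  | _, _, skip p => Del.skip p.toHom
  | _, _, push p => Del.push p.toHom

/-- The last constructor is read off from the map: `push` if the top of the domain goes to the top
of the codomain, `skip` otherwise. -/
theorem toHom_injective : ∀ {m n : ℕ} (p q : Path m n), p.toHom = q.toHom → p = q
  | _, _, nil, nil, _ => rfl
  | _, _, skip p, skip q, h => by
    refine congrArg skip (toHom_injective p q (hom_ext fun i => ?_))
    exact congrArg (fun f : (⟨_⟩ : Del) ⟶ ⟨_ + 1⟩ => (Hom.toFun f i).val) h
  | _, _, push p, push q, h => by
    refine congrArg push (toHom_injective p q (hom_ext fun i => ?_))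
    have := congrArg (fun f => (Hom.toFun f ⟨i.val, Nat.lt_succ_of_lt i.isLt⟩).val) h
    dsimp only [toHom] at this
    rwa [push_lt _ _ i.isLt, push_lt _ _ i.isLt] at this
  | m + 1, n + 1, skip p, push q, h => by
    have := congrArg (fun f => (Hom.toFun f ⟨m, Nat.lt_succ_self m⟩).val) h
    dsimp only [toHom] at this
    rw [push_last _ _ (lt_irrefl m)] at this
    exact absurd this (p.toHom.toFun ⟨m, Nat.lt_succ_self m⟩).isLt.ne
  | m + 1, n + 1, push p, skip q, h => by
    have := congrArg (fun f => (Hom.toFun f ⟨m, Nat.lt_succ_self m⟩).val) h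
    dsimp only [toHom] at this
    rw [push_last _ _ (lt_irrefl m)] at this
    exact absurd this.symm (q.toHom.toFun ⟨m, Nat.lt_succ_self m⟩).isLt.ne

theorem toHom_surjective : ∀ (m n : ℕ) (f : (⟨m⟩ : Del) ⟶ ⟨n⟩), ∃ p : Path m n, p.toHom = f
  | 0, 0, f => ⟨nil, hom_ext fun i => i.elim0⟩
  | m + 1, 0, f => (f.toFun ⟨0, Nat.succ_pos m⟩).elim0
  | 0, n + 1, f => by
    obtain ⟨p, -⟩ := toHom_surjective 0 n ⟨fun i => i.elim0, fun i => i.elim0⟩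
    exact ⟨skip p, hom_ext fun i => i.elim0⟩
  | m + 1, n + 1, f => by
    -- If the top point reaches the top value, it is peeled off the domain; otherwise monotonicity
    -- keeps every value below the top, which is peeled off the codomain.
    by_cases h : (f.toFun ⟨m, Nat.lt_succ_self m⟩).val = n
    · obtain ⟨p, hp⟩ := toHom_surjective m (n + 1)
        ⟨fun i => f.toFun ⟨i.val, Nat.lt_succ_of_lt i.isLt⟩, fun i j hij => f.mono hij⟩
      refine ⟨push p, hom_ext fun i => ?_⟩
      change ((Del.push p.toHom).toFun ⟨i.val, i.isLt⟩).val = _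
      by_cases hi : i.val < m
      · rw [push_lt _ _ hi, hp]
      · have hm : (⟨m, Nat.lt_succ_self m⟩ : Fin (m + 1)) = i :=
          Fin.ext (show m = i.val by have : i.val < m + 1 := i.isLt; omega)
        rw [push_last _ _ hi]
        exact h.symm.trans (congrArg (fun j => (f.toFun j).val) hm)
    · have hn : ∀ i, (f.toFun i).val < n := fun i => by
        have h₁ : (f.toFun i).val ≤ (f.toFun ⟨m, Nat.lt_succ_self m⟩).val :=
          f.mono (Nat.le_of_lt_succ i.isLt)
        have h₂ : (f.toFun ⟨m, Nat.lt_succ_self m⟩).val < n + 1 := Fin.isLt _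
        omega
      obtain ⟨p, hp⟩ := toHom_surjective (m + 1) n
        ⟨fun i => ⟨(f.toFun i).val, hn i⟩, fun i j hij => f.mono hij⟩
      refine ⟨skip p, hom_ext fun i => ?_⟩
      change (p.toHom.toFun i).val = _
      rw [hp]

/-- The path encoding a monotone map. -/
noncomputable def ofHom {m n : Del} (f : m ⟶ n) : Path m.card n.card :=
  (toHom_surjective m.card n.card f).choose

theorem toHom_ofHom {m n : Del} (f : m ⟶ n) : (ofHom f).toHom = f :=
  (toHom_surjective m.card n.card f).choose_spec

theorem ofHom_eq {m n : ℕ} (f : (⟨m⟩ : Del) ⟶ ⟨n⟩) (p : Path m n) (h : p.toHom = f) :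
    ofHom f = p :=
  toHom_injective _ _ ((toHom_ofHom f).trans h.symm)

/-- Composition of paths. -/
def comp : ∀ {k m n : ℕ}, Path k m → Path m n → Path k n
  | _, _, _, p, skip q => skip (comp p q)
  | _, _, _, skip p, push q => comp p q
  | _, _, _, push p, push q => push (comp p (push q))
  | _, _, _, nil, nil => nil
termination_by k m n => k + m + n

/-- When `p` skips the top of the middle ordinal, the value of `push q` there is irrelevant. When
both push, the top goes to the top and the rest is a composite with a smaller domain; the sum of the
three sizes decreases in each recursive call. -/
theorem toHom_comp : ∀ {k m n : ℕ} (p : Path k m) (q : Path m n),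
    (comp p q).toHom = p.toHom ≫ q.toHom
  | _, _, _, p, skip q => by
    rw [comp, toHom, toHom_comp p q]
    rfl
  | _, _, _, skip p, push q => by
    rw [comp, toHom_comp p q]
    exact hom_ext fun i => congrArg Fin.val (push_lt q.toHom _ (p.toHom.toFun i).isLt).symm
  | k + 1, _, _, push p, push q => by
    rw [comp, toHom, toHom_comp p (push q)]
    refine hom_ext fun i => ?_
    change ((Del.push _).toFun ⟨i.val, i.isLt⟩).val =
      ((Del.push q.toHom).toFun ((Del.push p.toHom).toFun ⟨i.val, i.isLt⟩)).val
    by_cases hi : i.val < k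
    · rw [push_lt _ _ hi, push_lt _ _ hi]
      rfl
    · rw [push_last _ _ hi]
      exact (push_last q.toHom _ (push_last p.toHom i.isLt hi).not_lt).symm
  | _, _, _, nil, nil => by
    rw [comp]
    rfl
termination_by k m n => k + m + n

/-- The path encoding an identity. -/
def id : ∀ n : ℕ, Path n n
  | 0 => nil
  | n + 1 => push (skip (id n))

/-- The path encoding `f + k`. -/
def addRight {m n : ℕ} (p : Path m n) : ∀ k : ℕ, Path (m + k) (n + k)
  | 0 => p
  | k + 1 => push (skip (addRight p k))

/-- The path encoding `k + f`. -/
def addLeft (k : ℕ) : ∀ {m n : ℕ}, Path m n → Path (k + m) (k + n)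
  | _, _, nil => id k
  | _, _, skip p => skip (addLeft k p)
  | _, _, push p => push (addLeft k p)

theorem toHom_id : ∀ n : ℕ, (id n).toHom = 𝟙 _
  | 0 => rfl
  | n + 1 => by
    refine hom_ext fun i => ?_
    change ((Del.push (Del.skip (id n).toHom)).toFun ⟨i.val, i.isLt⟩).val = i.val
    by_cases hi : i.val < n
    · rw [push_lt _ _ hi, toHom_id n]
      rfl
    · rw [push_last _ _ hi]
      have : i.val < n + 1 := i.isLt
      omega

theorem toHom_addRight {m n : ℕ} (p : Path m n) : ∀ k : ℕ,
    (addRight p k).toHom = Del.sumHom p.toHom (𝟙 (⟨k⟩ : Del))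
  | 0 => (Del.sumHom_zero _).symm
  | k + 1 => by
    refine hom_ext fun i => ?_
    change ((Del.push (Del.skip (addRight p k).toHom)).toFun ⟨i.val, i.isLt⟩).val =
      ((Del.sumHom p.toHom (𝟙 (⟨k + 1⟩ : Del))).toFun ⟨i.val, i.isLt⟩).val
    have hi' : i.val < m + (k + 1) := i.isLt
    by_cases hi : i.val < m + k
    · rw [push_lt _ _ hi, toHom_addRight p k]
      change ((Del.sumHom p.toHom (𝟙 (⟨k⟩ : Del))).toFun ⟨i.val, hi⟩).val = _
      by_cases h : i.val < m
      · exact (Del.sumHom_lt p.toHom _ hi h).trans (Del.sumHom_lt p.toHom _ i.isLt h).symm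
      · exact (Del.sumHom_ge p.toHom (𝟙 (⟨k⟩ : Del)) hi (show m ≤ i.val by omega)
          (show i.val - m < k by omega)).trans
            (Del.sumHom_ge p.toHom (𝟙 (⟨k + 1⟩ : Del)) i.isLt (show m ≤ i.val by omega)
              (show i.val - m < k + 1 by omega)).symm
    · rw [push_last _ _ hi]
      refine Eq.trans ?_ (Del.sumHom_ge p.toHom (𝟙 (⟨k + 1⟩ : Del)) i.isLt
        (show m ≤ i.val by omega) (show i.val - m < k + 1 by omega)).symm
      change n + k = n + (i.val - m)
      omega

theorem toHom_addLeft (k : ℕ) : ∀ {m n : ℕ} (p : Path m n),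
    (addLeft k p).toHom = Del.sumHom (𝟙 (⟨k⟩ : Del)) p.toHom
  | _, _, nil => (toHom_id k).trans (Del.sumHom_id ⟨k⟩ ⟨0⟩).symm
  | m, n + 1, skip p => by
    refine hom_ext fun i => ?_
    change ((addLeft k p).toHom.toFun i).val =
      ((Del.sumHom (𝟙 (⟨k⟩ : Del)) (Del.skip p.toHom)).toFun i).val
    rw [toHom_addLeft k p]
    exact (Del.sumHom_val _ _ _).trans (Del.sumHom_val (𝟙 (⟨k⟩ : Del)) (Del.skip p.toHom) i).symm
  | m + 1, n + 1, push p => by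
    refine hom_ext fun i => ?_
    have hi' : i.val < k + (m + 1) := i.isLt
    change ((Del.push (addLeft k p).toHom).toFun ⟨i.val, i.isLt⟩).val =
      ((Del.sumHom (𝟙 (⟨k⟩ : Del)) (Del.push p.toHom)).toFun ⟨i.val, i.isLt⟩).val
    by_cases hi : i.val < k + m
    · rw [push_lt _ _ hi, toHom_addLeft k p]
      change ((Del.sumHom (𝟙 (⟨k⟩ : Del)) p.toHom).toFun ⟨i.val, hi⟩).val = _
      by_cases h : i.val < k
      · exact (Del.sumHom_lt (𝟙 (⟨k⟩ : Del)) p.toHom hi h).trans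
          (Del.sumHom_lt (𝟙 (⟨k⟩ : Del)) (Del.push p.toHom) i.isLt h).symm
      · have h₁ : i.val - k < m := by omega
        refine (Del.sumHom_ge (𝟙 (⟨k⟩ : Del)) p.toHom hi (show k ≤ i.val by omega) h₁).trans ?_
        refine Eq.trans ?_ (Del.sumHom_ge (𝟙 (⟨k⟩ : Del)) (Del.push p.toHom) i.isLt
          (show k ≤ i.val by omega) (show i.val - k < m + 1 by omega)).symm
        exact congrArg (fun j : Fin (n + 1) => k + j.val) (push_lt p.toHom _ h₁).symm
    · rw [push_last _ _ hi]
      refine Eq.trans ?_ (Del.sumHom_ge (𝟙 (⟨k⟩ : Del)) (Del.push p.toHom) i.isLt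
        (show k ≤ i.val by omega) (show i.val - k < m + 1 by omega)).symm
      exact congrArg (k + ·) (push_last p.toHom _ (show ¬ i.val - k < m by omega)).symm

end Path

end Del

/-! ### Monad laws in Kleisli form, whiskered by a 1-cell. -/

namespace Mnd

section Cells

variable {B : Type u} [Bicategory.{w, v} B] (S : Mnd B)

/-- Insertion of the unit in front of a `1`-cell. -/
def unitAt {X : B} (h : S.carrier ⟶ X) : h ⟶ S.t ≫ h := (λ_ h).inv ≫ S.unit ▷ h

/-- Multiplication in front of a `1`-cell. -/
def mulAt {X : B} (h : S.carrier ⟶ X) : S.t ≫ S.t ≫ h ⟶ S.t ≫ h :=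
  (α_ S.t S.t h).inv ≫ S.mul ▷ h

variable {X : B} {h k : S.carrier ⟶ X}

theorem unitAt_naturality (σ : h ⟶ k) : S.unitAt h ≫ S.t ◁ σ = σ ≫ S.unitAt k := by
  simp only [unitAt, Category.assoc]
  rw [← whisker_exchange, ← leftUnitor_inv_naturality_assoc]

theorem mulAt_naturality (σ : h ⟶ k) :
    S.mulAt h ≫ S.t ◁ σ = S.t ◁ S.t ◁ σ ≫ S.mulAt k := by
  simp only [mulAt, Category.assoc]
  rw [← whisker_exchange]
  simp

variable (h)

theorem unitAt_mulAt : S.unitAt (S.t ≫ h) ≫ S.mulAt h = 𝟙 _ := by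
  have := congrArg (· ▷ h) S.unit_mul
  rw [comp_whiskerRight] at this
  simp only [unitAt, mulAt, Category.assoc]
  rw [whiskerRight_comp]
  simp [this]

theorem whiskerLeft_unitAt_mulAt : S.t ◁ S.unitAt h ≫ S.mulAt h = 𝟙 _ := by
  have := congrArg (· ▷ h) S.mul_unit
  rw [comp_whiskerRight, whisker_assoc] at this
  simp only [Category.assoc] at this
  have e : S.t ◁ (λ_ h).inv = (ρ_ S.t).inv ▷ h ≫ (α_ S.t (𝟙 _) h).hom := by simp
  simp only [unitAt, mulAt, whiskerLeft_comp, Category.assoc]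
  rw [e, Category.assoc, this, ← comp_whiskerRight, Iso.inv_hom_id, id_whiskerRight]

theorem whiskerLeft_mulAt_mulAt :
    S.t ◁ S.mulAt h ≫ S.mulAt h = S.mulAt (S.t ≫ h) ≫ S.mulAt h := by
  have := congrArg (· ▷ h) S.mul_mul
  simp only [comp_whiskerRight, whisker_assoc, Category.assoc] at this
  simp only [mulAt, Category.assoc, whiskerLeft_comp, whiskerRight_comp]
  rw [← cancel_epi (S.t ◁ (α_ S.t S.t h).hom), ← cancel_epi (α_ S.t (S.t ≫ S.t) h).hom,
    ← cancel_epi ((α_ S.t S.t S.t).hom ▷ h)]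
  simp [← this]

variable {h} {l : S.carrier ⟶ X}

/-- With `S.t ◁ τ ≫ S.mulAt k` read as the Kleisli extension of `τ`, this and the next two lemmas
are the laws of a Kleisli triple, with `σ` carried along. They match the clauses of path
composition. -/
theorem comp_unitAt_mulAt (σ : l ⟶ h) (τ : h ⟶ S.t ≫ k) :
    (σ ≫ S.unitAt h) ≫ S.t ◁ τ ≫ S.mulAt k = σ ≫ τ := by
  rw [Category.assoc, reassoc_of% (S.unitAt_naturality τ), unitAt_mulAt, Category.comp_id]

theorem whiskerLeft_comp_mulAt (σ : l ⟶ S.t ≫ h) (τ : h ⟶ S.t ≫ k) :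
    S.t ◁ (σ ≫ S.t ◁ τ ≫ S.mulAt k) ≫ S.mulAt k =
      (S.t ◁ σ ≫ S.mulAt h) ≫ S.t ◁ τ ≫ S.mulAt k := by
  rw [Category.assoc, reassoc_of% (S.mulAt_naturality τ), whiskerLeft_comp, whiskerLeft_comp,
    Category.assoc, Category.assoc, whiskerLeft_mulAt_mulAt]

theorem whiskerLeft_comp_unitAt_mulAt (σ : l ⟶ h) :
    S.t ◁ (σ ≫ S.unitAt h) ≫ S.mulAt h = S.t ◁ σ := by
  rw [whiskerLeft_comp, Category.assoc, whiskerLeft_unitAt_mulAt, Category.comp_id]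

end Cells

/-! ### The 2-functor generated by a monad. -/

section Iterate

variable {D : Type u} [Bicategory.{w, v} D] (S : Mnd D)

/-- The iterates of a monad. -/
def iter : ℕ → (S.carrier ⟶ S.carrier)
  | 0 => 𝟙 _
  | n + 1 => S.t ≫ iter n

/-- The `2`-cell between iterates of a monad given by a path. -/
def realize : ∀ {m n : ℕ}, Del.Path m n → (S.iter m ⟶ S.iter n)
  | _, _, .nil => 𝟙 _
  | _, _, .skip p => realize p ≫ S.unitAt _
  | _, _, .push p => S.t ◁ realize p ≫ S.mulAt _

theorem realize_id : ∀ n : ℕ, S.realize (Del.Path.id n) = 𝟙 _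
  | 0 => rfl
  | n + 1 => (S.whiskerLeft_comp_unitAt_mulAt (S.realize (Del.Path.id n))).trans
    ((congrArg (S.t ◁ ·) (realize_id n)).trans (whiskerLeft_id _ _))

/-- Interpreting `skip` as the unit and `push` as Kleisli extension turns the three recursive
clauses of `Del.Path.comp` into associativity of composition, the unit law of extension and its
associativity law. -/
theorem realize_comp : ∀ {k m n : ℕ} (p : Del.Path k m) (q : Del.Path m n),
    S.realize (p.comp q) = S.realize p ≫ S.realize q
  | _, _, _, p, .skip q => by
    rw [Del.Path.comp, realize, realize_comp p q]
    exact Category.assoc _ _ _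
  | _, _, _, .skip p, .push q => by
    rw [Del.Path.comp, realize_comp p q]
    exact (S.comp_unitAt_mulAt _ _).symm
  | _, _, _, .push p, .push q => by
    rw [Del.Path.comp, realize, realize_comp p (.push q)]
    exact S.whiskerLeft_comp_mulAt (S.realize p) (S.realize q)
  | _, _, _, .nil, .nil => by
    rw [Del.Path.comp, realize, Category.id_comp]
termination_by k m n => k + m + n

/-- The `2`-cell between iterates of a monad given by a monotone map. -/
noncomputable def realizeHom {m n : Del} (f : m ⟶ n) : S.iter m.card ⟶ S.iter n.card :=
  S.realize (Del.Path.ofHom f)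

/-- By uniqueness of paths, any convenient path may be used to compute the cell; this hides the
choice made in `Del.Path.ofHom`. -/
theorem realizeHom_eq {m n : ℕ} (f : (⟨m⟩ : Del) ⟶ ⟨n⟩) (p : Del.Path m n) (h : p.toHom = f) :
    S.realizeHom f = S.realize p :=
  congrArg S.realize (Del.Path.ofHom_eq f p h)

theorem realizeHom_id (n : Del) : S.realizeHom (𝟙 n) = 𝟙 _ :=
  (S.realizeHom_eq _ _ (Del.Path.toHom_id n.card)).trans (S.realize_id n.card)

theorem realizeHom_comp {k m n : Del} (f : k ⟶ m) (g : m ⟶ n) :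
    S.realizeHom (f ≫ g) = S.realizeHom f ≫ S.realizeHom g :=
  (S.realizeHom_eq _ _ ((Del.Path.toHom_comp (.ofHom f) (.ofHom g)).trans
    (congrArg₂ (· ≫ ·) (Del.Path.toHom_ofHom f) (Del.Path.toHom_ofHom g)))).trans
      (S.realize_comp _ _)

theorem ext_heq {S S' : Mnd D} (hc : S.carrier = S'.carrier) (ht : S.t ≍ S'.t)
    (hu : S.unit ≍ S'.unit) (hm : S.mul ≍ S'.mul) : S = S' := by
  cases S
  cases S'
  dsimp only at hc
  subst hc
  cases ht
  cases hu
  cases hm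
  rfl

variable [Bicategory.Strict D]

theorem iter_add (m : ℕ) : ∀ n : ℕ, S.iter (m + n) = S.iter n ≫ S.iter m
  | 0 => (Strict.id_comp _).symm
  | n + 1 => (congrArg (S.t ≫ ·) (iter_add m n)).trans (Strict.assoc _ _ _).symm

theorem unitAt_heq {X : D} (h : S.carrier ⟶ X) : S.unitAt h ≍ S.unit ▷ h := by
  rw [unitAt, Strict.leftUnitor_eqToIso, eqToIso.inv]
  exact eqToHom_comp_heq _ _

theorem mulAt_heq {X : D} (h : S.carrier ⟶ X) : S.mulAt h ≍ S.mul ▷ h :=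
  associator_inv_comp_heq _ _ _ _

theorem unitAt_comp {X Y : D} (h : S.carrier ⟶ X) (k : X ⟶ Y) :
    S.unitAt (h ≫ k) ≍ S.unitAt h ▷ k :=
  (S.unitAt_heq _).trans <| (whiskerRight_comp_heq _ _ _).trans <|
    whiskerRight_heq rfl (Strict.id_comp h) rfl (S.unitAt_heq h).symm

theorem mulAt_comp {X Y : D} (h : S.carrier ⟶ X) (k : X ⟶ Y) :
    S.mulAt (h ≫ k) ≍ S.mulAt h ▷ k :=
  (S.mulAt_heq _).trans <| (whiskerRight_comp_heq _ _ _).trans <|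
    whiskerRight_heq rfl (Strict.assoc _ _ h) rfl (S.mulAt_heq h).symm

theorem unitAt_congr {X : D} {h k : S.carrier ⟶ X} (e : h = k) : S.unitAt h ≍ S.unitAt k := by
  rw [e]

theorem mulAt_congr {X : D} {h k : S.carrier ⟶ X} (e : h = k) : S.mulAt h ≍ S.mulAt k := by
  rw [e]

/-- Each extra top point contributes a `skip` followed by a `push`, that is, the Kleisli extension
of something composed with the unit, which is plain whiskering by `S.t`. -/
theorem realize_addRight {m n : ℕ} (p : Del.Path m n) : ∀ k : ℕ,
    S.realize (p.addRight k) ≍ S.iter k ◁ S.realize p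
  | 0 => (id_whiskerLeft_heq _).symm
  | k + 1 => (heq_of_eq (S.whiskerLeft_comp_unitAt_mulAt (S.realize (p.addRight k)))).trans <|
    (whiskerLeft_heq rfl (S.iter_add m k) (S.iter_add n k) (realize_addRight p k)).trans
      (comp_whiskerLeft_heq _ _ _).symm

/-- Here the induction is on the path: points added at the bottom lie behind the cells being built,
and `unitAt` and `mulAt` commute with composition on that side. -/
theorem realize_addLeft (k : ℕ) : ∀ {m n : ℕ} (p : Del.Path m n),
    S.realize (p.addLeft k) ≍ S.realize p ▷ S.iter k
  | _, _, .nil => by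
    refine (heq_of_eq (S.realize_id k)).trans ?_
    refine HEq.trans ?_ (heq_of_eq (id_whiskerRight (𝟙 S.carrier) (S.iter k)).symm)
    exact congr_arg_heq (fun f : S.carrier ⟶ S.carrier => 𝟙 f) (Strict.id_comp (S.iter k)).symm
  | m, _, .skip (n := n) p =>
    (heq_comp (S.iter_add k m) (S.iter_add k n) (S.iter_add k (n + 1)) (realize_addLeft k p)
      ((S.unitAt_congr (S.iter_add k n)).trans (S.unitAt_comp _ _))).trans
        (heq_of_eq (comp_whiskerRight _ _ _).symm)
  | _, _, .push (m := m) (n := n) p =>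
    (heq_comp (S.iter_add k (m + 1)) ((congrArg (S.t ≫ ·) (S.iter_add k (n + 1))).trans
      (Strict.assoc _ _ _).symm) (S.iter_add k (n + 1))
      ((whiskerLeft_heq rfl (S.iter_add k m) (S.iter_add k (n + 1)) (realize_addLeft k p)).trans
        (whisker_assoc_heq _ _ _).symm)
      ((S.mulAt_congr (S.iter_add k n)).trans (S.mulAt_comp _ _))).trans
        (heq_of_eq (comp_whiskerRight _ _ _).symm)

theorem realizeHom_sumHom_id {m n : Del} (f : m ⟶ n) (k : Del) :
    S.realizeHom (Del.sumHom f (𝟙 k)) ≍ S.iter k.card ◁ S.realizeHom f :=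
  (heq_of_eq (S.realizeHom_eq _ _ ((Del.Path.toHom_addRight (.ofHom f) k.card).trans
    (congrArg (fun g => Del.sumHom g (𝟙 k)) (Del.Path.toHom_ofHom f))))).trans
      (S.realize_addRight _ _)

theorem realizeHom_id_sumHom {m n : Del} (f : m ⟶ n) (k : Del) :
    S.realizeHom (Del.sumHom (𝟙 k) f) ≍ S.realizeHom f ▷ S.iter k.card :=
  (heq_of_eq (S.realizeHom_eq _ _ ((Del.Path.toHom_addLeft k.card (.ofHom f)).trans
    (congrArg (Del.sumHom (𝟙 k)) (Del.Path.toHom_ofHom f))))).trans (S.realize_addLeft _ _)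

/-- The `2`-functor on the simplicial `2`-category given by a monad. -/
noncomputable def toSimplicial : StrictPseudofunctor BDel D :=
  StrictPseudofunctor.mk''
    { obj := fun _ => S.carrier
      map := fun n => S.iter (Del.card n)
      map₂ := fun f => S.realizeHom f
      map₂_id := fun n => S.realizeHom_id n
      map₂_comp := fun f g => S.realizeHom_comp f g
      map_id := fun _ => rfl
      map_comp := fun m n => S.iter_add (Del.card n) (Del.card m)
      map₂_whisker_left := fun m _ _ f => heq_conj (S.realizeHom_sumHom_id f m)
      map₂_whisker_right := fun f n => heq_conj (S.realizeHom_id_sumHom f n) }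

theorem monadOf_toSimplicial : monadOf S.toSimplicial = S := by
  refine ext_heq rfl (heq_of_eq (Strict.comp_id S.t)) ?_ ?_
  · refine (monadOf_unit_heq _).trans ?_
    have h : S.realizeHom (Del.bang ⟨0⟩) = S.unitAt (𝟙 _) :=
      (S.realizeHom_eq _ (.skip .nil) (Del.hom_one_ext _ _)).trans (Category.id_comp _)
    exact (heq_of_eq h).trans ((S.unitAt_heq _).trans (whiskerRight_id_heq _))
  · refine (monadOf_mul_heq _).trans ?_
    have h : S.realizeHom (Del.bang ⟨2⟩) = S.mulAt (𝟙 _) := by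
      -- The map `2 → 1` sends its top point to the top and is the identity on the rest, so its cell
      -- is the Kleisli extension of an identity, which is the multiplication.
      refine (S.realizeHom_eq _ (.push (Del.Path.id 1)) (Del.hom_one_ext _ _)).trans ?_
      change S.t ◁ S.realize (Del.Path.id 1) ≫ S.mulAt (𝟙 _) = _
      rw [realize_id, whiskerLeft_id]
      exact Category.id_comp _
    exact (heq_of_eq h).trans ((S.mulAt_heq _).trans (whiskerRight_id_heq _))

end Iterate

end Mnd

end TwoDim

theorem mainTheorem5 (D : Type u) [Bicategory.{w, v} D] [Bicategory.Strict D] :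
    (TwoDim.AdmitsKleisliObjects D ↔
      ∀ T : StrictPseudofunctor TwoDim.BDel D,
        TwoDim.HasWeightedColimit TwoDim.weightR T) ∧
    ((∀ M : TwoDim.Mnd D, TwoDim.HasKleisliObject M) ↔
      ∀ T : StrictPseudofunctor TwoDim.BDel D,
        TwoDim.HasWeightedColimit TwoDim.weightR T) := by
  have h : (∀ M : TwoDim.Mnd D, TwoDim.HasKleisliObject M) ↔
      ∀ T : StrictPseudofunctor TwoDim.BDel D,
        TwoDim.HasWeightedColimit TwoDim.weightR T := by
    refine ⟨fun h T => (h (TwoDim.monadOf T)).of_iso (TwoDim.coconeIso T).symm, fun h M => ?_⟩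
    -- The equality of monads holds on the nose, so `M` may be assumed to come from a 2-functor.
    rw [← M.monadOf_toSimplicial]
    exact (h M.toSimplicial).of_iso (TwoDim.coconeIso _)
  exact ⟨(TwoDim.exists_leftAdjoint_iff (TwoDim.Mnd.incl D)).trans h, h⟩
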